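/- Let $f:[0,1]\to(0,1)$ be of class $C^3$. An urn process associated to $f$ is a Markov chain $((\alpha_n,l_n))_{n\ge 0}$ on $[0,1]\times(0,\infty)$ such that $l_{n+1}=l_n+1$ and, given the past, $\alpha_{n+1}=\frac{l_n\alpha_n+1}{l_n+1}$ (a Red draw) with probability $f(\alpha_n)$ and $\alpha_{n+1}=\frac{l_n\alpha_n}{l_n+1}$ with probability $1-f(\alpha_n)$. Let $w_0=(\alpha_0^x,l_0^x)_{x\in\mathbb Z}\in([0,1]\times(0,\infty))^{\mathbb Z}$, and let $((\alpha^x_n,l^x_n))_{n\ge 0}$, $x\in\mathbb Z$, be independent urn processes associated to $f$, started from $(\alpha_0^x,l_0^x)$. The generalized reinforced random walk $(X_n)_{n\ge0}$ on $\mathbb Z$ starts at $X_0=0$; at its $(k+1)$-st visit to a site $x$ it jumps to $x+1$ if the $(k+1)$-st draw of the urn at $x$ is Red, and to $x-1$ otherwise. Let $R$ be the event that $X$ visits every site infinitely often, and for $x\in\mathbb Z$ put $$\delta_n^x=\sum_{k=0}^{n}(2f(\alpha_k^x)-1),\qquad \delta_\infty^x=\lim_{n\to\infty}\delta_n^x .$$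 Theorem. Assume that $w_0^x=w_0^1$ for all $x\ge 1$ and $w_0^x=w_0^{-1}$ for all $x\le -1$, and that $f$ has a unique fixed point $p\in[0,1]$. (1) If $p\ne 1/2$, then $\mathbb P[R]=0$. (2) If $p=1/2$ and $f'(1/2)=0$, then each of the conditions $\mathbb E[\delta^1_\infty]>1$ and $\mathbb E[\delta^{-1}_\infty]<-1$ implies $\mathbb P[R]=0$. Moreover, both in case (1) and in case (2) (before any condition on the expectations), for every $x\in\mathbb Z$ the quantities $\delta^x_\infty$ and $\mathbb E[\delta^x_\infty]$ are well defined: almost surely $\delta^x_n$ converges in $[-\infty,\infty]$, at least one of $\mathbb E\big[\sum_{k\ge0}(2f(\alpha_k^x)-1)_+\big]$ and $\mathbb E\big[\sum_{k\ge0}(2f(\alpha_k^x)-1)_-\big]$ is finite, and hence $\mathbb E[\delta_\infty^x]\in[-\infty,\infty]$ exists. -/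

import Mathlib

open MeasureTheory Filter Topology

noncomputable section

namespace RRW

/-- The state `(α, l)` of an urn: proportion of Red balls and total number of balls. -/
abbrev UrnState := ℝ × ℝ

/-- One draw from an urn in state `(α, l)`, driven by a number `u` which will be uniform on `[0,1]`:
a Red ball is drawn when `u < f α` (hence with probability `f α`), and then `α` becomes
`(l α + 1) / (l + 1)`; otherwise `α` becomes `l α / (l + 1)`. In both cases `l` becomes `l + 1`. -/
def urnStep (f : ℝ → ℝ) (u : unitInterval) (s : UrnState) : UrnState :=
  if (u : ℝ) < f s.1 then ((s.2 * s.1 + 1) / (s.2 + 1), s.2 + 1)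
  else (s.2 * s.1 / (s.2 + 1), s.2 + 1)

/-- The urn process `((α_n, l_n), n ≥ 0)` associated to `f`, started from `s` and driven by the
sequence `u`. If `u` is i.i.d. uniform, this is the Markov chain with the urn transitions. -/
def urn (f : ℝ → ℝ) (s : UrnState) (u : ℕ → unitInterval) : ℕ → UrnState
  | 0 => s
  | n + 1 => urnStep f (u n) (urn f s u n)

/-- Sample points: a sequence of numbers in `[0,1]` for every site of `ℤ`. -/
abbrev Sample := ℤ → ℕ → unitInterval

/-- All coordinates are independent and uniform on `[0,1]`; thus the urns attached to the sites
are independent. -/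
def sampleMeasure : Measure Sample :=
  Measure.infinitePi fun _ : ℤ => Measure.infinitePi fun _ : ℕ => (volume : Measure unitInterval)

/-- The proportion `α_k^x` of the urn at site `x` after `k` draws, when the initial environment
is `w`. -/
def alpha (f : ℝ → ℝ) (w : ℤ → UrnState) (ω : Sample) (x : ℤ) (k : ℕ) : ℝ :=
  (urn f (w x) (ω x) k).1

/-- The pair `(X_n, L_n)` formed by the position of the walk and the local times
`L_n^x = #{k < n : X_k = x}`. The walk starts at `0`; when it is at `x` for the `(k+1)`-st time,
it draws from the urn at `x` for the `(k+1)`-st time, and jumps to `x + 1` if the ball is Red and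
to `x - 1` otherwise. -/
def walkState (f : ℝ → ℝ) (w : ℤ → UrnState) (ω : Sample) : ℕ → ℤ × (ℤ → ℕ)
  | 0 => (0, fun _ => 0)
  | n + 1 =>
    let x := (walkState f w ω n).1
    let L := (walkState f w ω n).2
    (if (ω x (L x) : ℝ) < f (alpha f w ω x (L x)) then x + 1 else x - 1,
      Function.update L x (L x + 1))

/-- The generalized reinforced random walk `X_n` associated to `f`, started at `(0, w)`. -/
def walk (f : ℝ → ℝ) (w : ℤ → UrnState) (ω : Sample) (n : ℕ) : ℤ :=
  (walkState f w ω n).1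

/-- The event of recurrence: every site is visited infinitely often. -/
def recurrence (f : ℝ → ℝ) (w : ℤ → UrnState) : Set Sample :=
  {ω | ∀ x : ℤ, ∃ᶠ n in atTop, walk f w ω n = x}

/-- The drift `δ_n^x = ∑_{k=0}^n (2 f(α_k^x) - 1)`. -/
def drift (f : ℝ → ℝ) (w : ℤ → UrnState) (x : ℤ) (n : ℕ) (ω : Sample) : ℝ :=
  ∑ k ∈ Finset.range (n + 1), (2 * f (alpha f w ω x k) - 1)

/-- `δ_∞^x`, the limit in `[-∞, ∞]` of `δ_n^x` (written as a lower limit, which is the limit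
whenever the limit exists). -/
def driftLimit (f : ℝ → ℝ) (w : ℤ → UrnState) (x : ℤ) (ω : Sample) : EReal :=
  liminf (fun n : ℕ => (drift f w x n ω : EReal)) atTop

/-- `∑_{k≥0} (2 f(α_k^x) - 1)_+`. -/
def driftPos (f : ℝ → ℝ) (w : ℤ → UrnState) (x : ℤ) (ω : Sample) : ENNReal :=
  ∑' k : ℕ, ENNReal.ofReal (2 * f (alpha f w ω x k) - 1)

/-- `∑_{k≥0} (2 f(α_k^x) - 1)_-`. -/
def driftNeg (f : ℝ → ℝ) (w : ℤ → UrnState) (x : ℤ) (ω : Sample) : ENNReal :=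
  ∑' k : ℕ, ENNReal.ofReal (-(2 * f (alpha f w ω x k) - 1))

/-- The expectation of an extended-real random variable `Y` is well defined:
`E[Y_+] < ∞` or `E[Y_-] < ∞`. -/
def HasExpectation {Ω : Type*} [MeasurableSpace Ω] (μ : Measure Ω) (Y : Ω → EReal) : Prop :=
  ∫⁻ ω, (Y ω).toENNReal ∂μ < ⊤ ∨ ∫⁻ ω, (-Y ω).toENNReal ∂μ < ⊤

/-- The expectation `E[Y] = E[Y_+] - E[Y_-] ∈ [-∞, ∞]` of an extended-real random variable;
meaningful under `HasExpectation`. -/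
def expectation {Ω : Type*} [MeasurableSpace Ω] (μ : Measure Ω) (Y : Ω → EReal) : EReal :=
  ((∫⁻ ω, (Y ω).toENNReal ∂μ : ENNReal) : EReal) - ((∫⁻ ω, (-Y ω).toENNReal ∂μ : ENNReal) : EReal)

/-- `δ_∞^x` and `E[δ_∞^x]` are well defined: `δ_n^x` converges a.s. in `[-∞, ∞]`, the positive or
the negative part of the accumulated drift has finite mean, and the expectation of the limit
exists in `[-∞, ∞]`. -/
def DriftWellDefined (f : ℝ → ℝ) (w : ℤ → UrnState) (x : ℤ) : Prop :=
  (∀ᵐ ω ∂sampleMeasure,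
    Tendsto (fun n : ℕ => (drift f w x n ω : EReal)) atTop (𝓝 (driftLimit f w x ω))) ∧
  (∫⁻ ω, driftPos f w x ω ∂sampleMeasure < ⊤ ∨ ∫⁻ ω, driftNeg f w x ω ∂sampleMeasure < ⊤) ∧
  HasExpectation sampleMeasure (driftLimit f w x)

end RRW

end

/-!
Fix a random walk driven by the urns. On its visits to `i` up to the `(j + 1)`-st jump to the right,
it makes `F i j` jumps to the left, where `F i j` counts the draws of the other colour before the
`(j + 1)`-st Red one. As jumps across an edge alternate, if the walk is recurrent then the numbers
of jumps to the left are controlled, from a far level backwards, by the chain `j ↦ F i j`, started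
from `0`; so it is enough to find a level at which this chain vanishes whatever the starting level.

By optional stopping, the mean of `F i j` is `j + 1` minus the mean of the drift
`∑ (2 f(α_k) - 1)` accumulated up to the `(j + 1)`-st Red draw. If the total drift has mean larger
than `1`, then the chain has a drift to the left that is bounded away from `0` outside a finite set
`{0, …, K - 1}`. The probability that it is in this set hence does not tend to `0`; as `f` is
bounded away from `0`, neither does the probability that it is at `0`. A zero-one law for the
independent urns provides the level. The left side follows by reflection and exchange of the
colours.

The urn is a stochastic approximation whose mean increments point to the unique fixed point `p`. A
potential `l * (|α - p| - ρ)₊ ^ n` shows that the mean number of times spent away from `p` is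
finite. If `p ≠ 1/2`, the total drift thus has an infinite mean of the sign of `p - 1/2`. If
`p = 1/2` is a critical point of `f`, either it is a local extremum, and the drift has a sign near
`1/2`, or the second derivative vanishes there, and the drift is at most cubic in `α - 1/2`, whose
third power is summable in mean by means of the potential `l * |α - 1/2| ^ 3`.
-/

namespace RRW

open ProbabilityTheory
open scoped ENNReal

section GeneratedBy

variable {ι Ω β γ δ : Type*} [MeasurableSpace β] [MeasurableSpace γ] [MeasurableSpace δ]

/-- The σ-algebra `σ(X i, i ∈ T)` generated by a subfamily of a family of random variables. It
serves both for the past of an urn (`T = Set.Iio k`) and for the tails of a sequence of urns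
(`T = Set.Ici i`). -/
abbrev generatedBy (X : ι → Ω → β) (T : Set ι) : MeasurableSpace Ω :=
  ⨆ i ∈ T, MeasurableSpace.comap (X i) inferInstance

variable {X : ι → Ω → β} {T T' : Set ι}

lemma generatedBy_mono (h : T ⊆ T') : generatedBy X T ≤ generatedBy X T' :=
  biSup_mono h

lemma measurable_generatedBy {i : ι} (hi : i ∈ T) : Measurable[generatedBy X T] (X i) :=
  (comap_measurable (X i)).mono
    (le_biSup (fun i => MeasurableSpace.comap (X i) inferInstance) hi) le_rfl

variable [mΩ : MeasurableSpace Ω] {P : Measure Ω}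

lemma generatedBy_le (hX : ∀ i, Measurable (X i)) : generatedBy X T ≤ mΩ :=
  iSup₂_le fun i _ => (hX i).comap_le

lemma indepFun_of_disjoint (hX : ∀ i, Measurable (X i)) (hind : iIndepFun X P)
    (hT : Disjoint T T') {Y : Ω → γ} {Z : Ω → δ} (hY : Measurable[generatedBy X T] Y)
    (hZ : Measurable[generatedBy X T'] Z) : IndepFun Y Z P := by
  rw [IndepFun_iff_Indep]
  exact indep_of_indep_of_le_left (indep_of_indep_of_le_right
    (indep_iSup_of_disjoint (fun i => (hX i).comap_le) hind hT) hZ.comap_le) hY.comap_le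

lemma le_measure_limsup [IsFiniteMeasure P] {A : ℕ → Set Ω} (hA : ∀ n, MeasurableSet (A n))
    {c : ℝ≥0∞} (hc : ∃ᶠ n in atTop, c ≤ P (A n)) : c ≤ P (limsup A atTop) := by
  have hlim := tendsto_measure_iInter_atTop (μ := P) (s := fun n => ⨆ m ≥ n, A m)
    (fun n => (MeasurableSet.biUnion (Set.to_countable _) fun m _ => hA m).nullMeasurableSet)
    (fun n m hnm => Set.biUnion_subset_biUnion_left (Set.Ici_subset_Ici.2 hnm))
    ⟨0, measure_ne_top _ _⟩
  rw [limsup_eq_iInf_iSup_of_nat]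
  refine ge_of_tendsto' hlim fun n => ?_
  obtain ⟨m, hnm, hm⟩ := frequently_atTop.1 hc n
  exact hm.trans (measure_mono (Set.subset_biUnion_of_mem (u := A) (Set.mem_Ici.2 hnm)))

lemma ae_frequently_mem_of_le_measure {X : ℕ → Ω → β} (hX : ∀ i, Measurable (X i))
    (hind : iIndepFun X P) {A : ℕ → Set Ω}
    (hA : ∀ i, MeasurableSet[generatedBy X (Set.Ici i)] (A i)) {c : ℝ≥0∞} (hc : 0 < c)
    (hcA : ∀ i, c ≤ P (A i)) : ∀ᵐ ω ∂P, ∃ᶠ i in atTop, ω ∈ A i := by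
  have : IsProbabilityMeasure P := hind.isProbabilityMeasure
  have hm : ∀ i, MeasurableSet (A i) := fun i => generatedBy_le hX _ (hA i)
  have htail : MeasurableSet[limsup (fun i => MeasurableSpace.comap (X i) inferInstance) atTop]
      (limsup A atTop) := by
    rw [limsup_eq_iInf_iSup_of_nat, MeasurableSpace.measurableSet_iInf]
    intro n
    rw [← limsup_nat_add A n]
    exact @MeasurableSet.measurableSet_limsup _ (generatedBy X (Set.Ici n)) _ fun i =>
      generatedBy_mono (Set.Ici_subset_Ici.2 (Nat.le_add_left n i)) _ (hA (i + n))
  have hpos : P (limsup A atTop) ≠ 0 :=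
    (hc.trans_le (le_measure_limsup hm (Frequently.of_forall hcA))).ne'
  have hae : ∀ᵐ ω ∂P, ω ∈ limsup A atTop :=
    (prob_compl_eq_zero_iff (MeasurableSet.measurableSet_limsup hm)).2 <|
      (measure_zero_or_one_of_measurableSet_limsup_atTop (fun i => (hX i).comap_le) hind
        htail).resolve_left hpos
  exact hae.mono fun ω hω => mem_limsup_iff_frequently_mem.1 hω

end GeneratedBy

/-! ### Coloured draws at a single site -/

section Reds

/-- The number of Red balls among the first `k` draws, `true` standing for Red. -/
def reds (b : ℕ → Bool) (k : ℕ) : ℕ := Nat.count (fun i => b i = true) k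

/-- The number of Red balls is infinite. -/
def InfinitelyRed (b : ℕ → Bool) : Prop := {k | b k = true}.Infinite

/-- The index of the `(j + 1)`-st Red draw; `0` if there is no such draw. -/
noncomputable def redTime (b : ℕ → Bool) (j : ℕ) : ℕ := Nat.nth (fun i => b i = true) j

/-- The number of draws of the other colour before the `(j + 1)`-st Red draw. -/
noncomputable def failures (b : ℕ → Bool) (j : ℕ) : ℕ := redTime b j - j

variable {b : ℕ → Bool} {k j : ℕ}

lemma reds_zero (b : ℕ → Bool) : reds b 0 = 0 := Nat.count_zero _

lemma reds_succ (b : ℕ → Bool) (k : ℕ) :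
    reds b (k + 1) = reds b k + if b k = true then 1 else 0 :=
  Nat.count_succ _ k

lemma reds_le (b : ℕ → Bool) (k : ℕ) : reds b k ≤ k := Nat.count_le _

lemma reds_mono (b : ℕ → Bool) : Monotone (reds b) := Nat.count_monotone _

lemma sub_reds_mono (b : ℕ → Bool) : Monotone fun k => k - reds b k := by
  refine monotone_nat_of_le_succ fun k => ?_
  have := reds_le b k
  rw [reds_succ]
  split_ifs <;> omega

lemma reds_not (b : ℕ → Bool) (k : ℕ) : reds (fun i => !b i) k = k - reds b k := by
  induction k with
  | zero => rfl
  | succ k ih =>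
    have := reds_le b k
    rw [reds_succ, reds_succ, ih]
    cases b k <;> simp only [Bool.not_true, Bool.not_false, if_true, Bool.false_eq_true, if_false]
      <;> omega

lemma reds_le_iff (hb : InfinitelyRed b) : reds b k ≤ j ↔ k ≤ redTime b j :=
  Nat.count_le_iff_le_nth hb

lemma reds_redTime (hb : InfinitelyRed b) (j : ℕ) : reds b (redTime b j) = j :=
  Nat.count_nth_of_infinite hb j

lemma reds_redTime_succ (hb : InfinitelyRed b) (j : ℕ) : reds b (redTime b j + 1) = j + 1 :=
  Nat.count_nth_succ_of_infinite hb j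

lemma failures_eq_sub_reds (hb : InfinitelyRed b) (j : ℕ) :
    failures b j = redTime b j - reds b (redTime b j) := by
  rw [failures, reds_redTime hb]

lemma sub_reds_le_failures (hb : InfinitelyRed b) (h : reds b k ≤ j) :
    k - reds b k ≤ failures b j := by
  rw [failures_eq_sub_reds hb]
  exact sub_reds_mono b ((reds_le_iff hb).1 h)

lemma failures_mono (hb : InfinitelyRed b) : Monotone (failures b) := by
  intro i j hij
  rw [failures_eq_sub_reds hb, failures_eq_sub_reds hb]
  exact sub_reds_mono b (Nat.nth_monotone hb hij)

lemma failures_eq_zero (h : reds b k = k) (hj : j < k) : failures b j = 0 := by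
  have hred : ∀ i < k, b i = true := fun i hi => Nat.count_iff_forall.1 h i hi
  rw [failures, redTime, Nat.nth_of_forall fun n hn => hred n (hn.trans_lt hj), Nat.sub_self]

lemma infinitelyRed_of_forall_exists_lt_reds (h : ∀ j, ∃ k, j < reds b k) : InfinitelyRed b := by
  intro hfin
  obtain ⟨k, hk⟩ := h hfin.toFinset.card
  exact hk.not_ge (Nat.count_le_card hfin k)

lemma sum_ite_reds_le_and_red (b : ℕ → Bool) (j m : ℕ) :
    ∑ k ∈ Finset.range m, (if reds b k ≤ j ∧ b k = true then 1 else 0) =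
      min (reds b m) (j + 1) := by
  induction m with
  | zero => rfl
  | succ m ih =>
    rw [Finset.sum_range_succ, ih, reds_succ]
    split_ifs <;> simp_all <;> omega

lemma tsum_ite_reds_le_and_red_le (b : ℕ → Bool) (j : ℕ) :
    ∑' k, (if reds b k ≤ j ∧ b k = true then (1 : ℝ≥0∞) else 0) ≤ j + 1 := by
  refine ENNReal.tsum_le_of_sum_range_le fun m => ?_
  have h := (sum_ite_reds_le_and_red b j m).trans_le (min_le_right _ _)
  exact_mod_cast h

lemma tsum_ite_reds_le (hb : InfinitelyRed b) (j : ℕ) (c : Bool) :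
    ∑' k, (if reds b k ≤ j ∧ b k = c then (1 : ℝ≥0∞) else 0) =
      Nat.count (fun k => b k = c) (redTime b j + 1) := by
  rw [tsum_eq_sum (s := Finset.range (redTime b j + 1)), Nat.count_eq_card_filter_range,
    Finset.card_filter, Nat.cast_sum]
  · refine Finset.sum_congr rfl fun k hk => ?_
    have hk' : reds b k ≤ j := (reds_le_iff hb).2 (Nat.lt_succ_iff.1 (Finset.mem_range.1 hk))
    simp only [hk', true_and, Nat.cast_ite, Nat.cast_one, Nat.cast_zero]
  · intro k hk
    refine if_neg fun h => hk (Finset.mem_range_succ_iff.2 ((reds_le_iff hb).1 h.1))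

lemma tsum_ite_reds_le_and_red (hb : InfinitelyRed b) (j : ℕ) :
    ∑' k, (if reds b k ≤ j ∧ b k = true then (1 : ℝ≥0∞) else 0) = j + 1 := by
  rw [tsum_ite_reds_le hb]
  exact_mod_cast reds_redTime_succ hb j

lemma tsum_ite_reds_le_and_not_red (hb : InfinitelyRed b) (j : ℕ) :
    ∑' k, (if reds b k ≤ j ∧ b k = false then (1 : ℝ≥0∞) else 0) = failures b j := by
  have hcount : Nat.count (fun k => b k = false) (redTime b j + 1) = failures b j := by
    have h := reds_not b (redTime b j + 1)
    rw [reds_redTime_succ hb, Nat.add_sub_add_right] at h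
    simpa only [reds, failures, Bool.not_eq_true'] using h
  rw [tsum_ite_reds_le hb, hcount]

lemma measurableSet_apply_eq (k : ℕ) (c : Bool) : MeasurableSet {b : ℕ → Bool | b k = c} :=
  measurableSet_eq_fun (measurable_pi_apply k) measurable_const

lemma measurable_reds (k : ℕ) : Measurable fun b : ℕ → Bool => reds b k := by
  induction k with
  | zero => exact measurable_const
  | succ k ih =>
    simp only [reds_succ]
    exact ih.add
      (Measurable.ite (measurableSet_apply_eq k true) measurable_const measurable_const)

lemma measurableSet_reds_eq (k j : ℕ) : MeasurableSet {b : ℕ → Bool | reds b k = j} :=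
  measurableSet_eq_fun (measurable_reds k) measurable_const

lemma lt_redTime_iff {m : ℕ} :
    m < redTime b j ↔ ∃ k > m, b k = true ∧ reds b k = j := by
  refine ⟨fun h => ⟨redTime b j, h, ?_, ?_⟩, ?_⟩
  · exact Nat.nth_mem_of_ne_zero (Nat.ne_zero_of_lt h)
  · exact Nat.count_nth fun hf => Nat.lt_card_toFinset_of_nth_ne_zero (Nat.ne_zero_of_lt h) hf
  · rintro ⟨k, hk, hbk, rfl⟩
    exact hk.trans_eq (Nat.nth_count hbk).symm

lemma measurable_redTime (j : ℕ) : Measurable fun b : ℕ → Bool => redTime b j := by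
  refine measurable_of_Ioi fun m => ?_
  have h : (fun b : ℕ → Bool => redTime b j) ⁻¹' Set.Ioi m =
      ⋃ k > m, {b | b k = true} ∩ {b | reds b k = j} := by
    ext b
    simp only [Set.mem_preimage, Set.mem_Ioi, lt_redTime_iff, Set.mem_iUnion, Set.mem_inter_iff,
      Set.mem_ofPred_eq, exists_prop]
  rw [h]
  exact MeasurableSet.biUnion (Set.to_countable _) fun k _ =>
    (measurableSet_apply_eq k true).inter (measurableSet_reds_eq k j)

lemma measurable_failures : Measurable fun q : (ℕ → Bool) × ℕ => failures q.1 q.2 :=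
  measurable_from_prod_countable_left fun j =>
    (measurable_of_countable fun n : ℕ => n - j).comp (measurable_redTime j)

end Reds

/-- The draws `r` at a site are Red with predictable probabilities `φ`, bounded below by `ε`, in the
sense that `φ` compensates the draws on every event that is determined by the number of Red draws
made so far. -/
structure IsCompensated {S : Type*} [MeasurableSpace S] (μ : Measure S) (r : S → ℕ → Bool)
    (φ : ℕ → S → ℝ) (ε : ℝ) : Prop where
  measurable_draw : Measurable r
  measurable_rate : ∀ k, Measurable (φ k)
  pos : 0 < ε
  le_rate : ∀ k s, ε ≤ φ k s
  rate_le : ∀ k s, φ k s ≤ 1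
  measure_draw : ∀ (c : Bool) (k : ℕ) (T : Set ℕ), μ {s | reds (r s) k ∈ T ∧ r s k = c} =
    ∫⁻ s in {s | reds (r s) k ∈ T}, ENNReal.ofReal (bif c then φ k s else 1 - φ k s) ∂μ

namespace IsCompensated

variable {S : Type*} [MeasurableSpace S] {μ : Measure S} {r : S → ℕ → Bool} {φ : ℕ → S → ℝ} {ε : ℝ}

lemma flip {ε' : ℝ} (h : IsCompensated μ r φ ε) (hε' : 0 < ε') (hφ : ∀ k s, φ k s ≤ 1 - ε') :
    IsCompensated μ (fun s k => !r s k) (fun k s => 1 - φ k s) ε' where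
  measurable_draw := measurable_pi_lambda _ fun k =>
    (measurable_of_countable not).comp ((measurable_pi_apply k).comp h.measurable_draw)
  measurable_rate k := measurable_const.sub (h.measurable_rate k)
  pos := hε'
  le_rate k s := by linarith [hφ k s]
  rate_le k s := by linarith [h.le_rate k s, h.pos]
  measure_draw c k T := by
    have h' := h.measure_draw (!c) k {j | k - j ∈ T}
    cases c <;> simpa [reds_not] using h'

lemma measurableSet_reds (h : IsCompensated μ r φ ε) (k : ℕ) (T : Set ℕ) :
    MeasurableSet {s | reds (r s) k ∈ T} :=
  ((measurable_reds k).comp h.measurable_draw) (MeasurableSet.of_discrete (s := T))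

lemma measurableSet_draw (h : IsCompensated μ r φ ε) (c : Bool) (k : ℕ) (T : Set ℕ) :
    MeasurableSet {s | reds (r s) k ∈ T ∧ r s k = c} :=
  (h.measurableSet_reds k T).inter
    (((measurable_pi_apply k).comp h.measurable_draw) (measurableSet_singleton c))

lemma mul_measure_reds_le (h : IsCompensated μ r φ ε) (k : ℕ) (T : Set ℕ) :
    ENNReal.ofReal ε * μ {s | reds (r s) k ∈ T} ≤ μ {s | reds (r s) k ∈ T ∧ r s k = true} := by
  rw [h.measure_draw, ← setLIntegral_const]
  exact lintegral_mono fun s => ENNReal.ofReal_le_ofReal (h.le_rate k s)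

lemma lintegral_tsum_ite (h : IsCompensated μ r φ ε) (j : ℕ) (c : Bool) :
    ∫⁻ s, ∑' k, (if reds (r s) k ≤ j ∧ r s k = c then (1 : ℝ≥0∞) else 0) ∂μ =
      ∑' k, μ {s | reds (r s) k ∈ Set.Iic j ∧ r s k = c} := by
  have hm := fun k => h.measurableSet_draw c k (Set.Iic j)
  have hind : ∀ k, (fun s => if reds (r s) k ≤ j ∧ r s k = c then (1 : ℝ≥0∞) else 0) =
      {s | reds (r s) k ∈ Set.Iic j ∧ r s k = c}.indicator 1 := fun k => by
    ext s
    simp [Set.indicator_apply]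
  rw [lintegral_tsum fun k => (hind k ▸ measurable_one.indicator (hm k)).aemeasurable]
  exact tsum_congr fun k => by rw [hind k, lintegral_indicator_one (hm k)]

lemma measure_reds_eq_pos [IsProbabilityMeasure μ] (h : IsCompensated μ r φ ε) (K : ℕ) :
    0 < μ {s | reds (r s) K = K} := by
  induction K with
  | zero => simp [reds_zero]
  | succ K ih =>
    have hred : {s | reds (r s) K ∈ ({K} : Set ℕ) ∧ r s K = true} ⊆
        {s | reds (r s) (K + 1) = K + 1} := by
      rintro s ⟨hK, hs⟩
      rw [Set.mem_ofPred_eq, reds_succ, if_pos hs, Set.mem_singleton_iff.1 hK]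
    calc 0 < ENNReal.ofReal ε * μ {s | reds (r s) K ∈ ({K} : Set ℕ)} :=
          ENNReal.mul_pos (ENNReal.ofReal_pos.2 h.pos).ne' ih.ne'
      _ ≤ μ {s | reds (r s) K ∈ ({K} : Set ℕ) ∧ r s K = true} := h.mul_measure_reds_le K {K}
      _ ≤ μ {s | reds (r s) (K + 1) = K + 1} := measure_mono hred

lemma tsum_measure_reds_ne_top [IsProbabilityMeasure μ] (h : IsCompensated μ r φ ε) (j : ℕ) :
    ∑' k, μ {s | reds (r s) k ∈ Set.Iic j} ≠ ⊤ := by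
  have hle : ENNReal.ofReal ε * ∑' k, μ {s | reds (r s) k ∈ Set.Iic j} ≤ j + 1 := by
    calc _ ≤ ∑' k, μ {s | reds (r s) k ∈ Set.Iic j ∧ r s k = true} := by
          rw [← ENNReal.tsum_mul_left]
          exact ENNReal.tsum_le_tsum fun k => h.mul_measure_reds_le k _
      _ ≤ ∫⁻ _, (j + 1 : ℝ≥0∞) ∂μ := by
          rw [← h.lintegral_tsum_ite]
          exact lintegral_mono fun s => tsum_ite_reds_le_and_red_le (r s) j
      _ = j + 1 := by rw [lintegral_const, measure_univ, mul_one]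
  intro htop
  rw [htop, ENNReal.mul_top (ENNReal.ofReal_pos.2 h.pos).ne'] at hle
  exact ENNReal.add_ne_top.2 ⟨ENNReal.natCast_ne_top j, ENNReal.one_ne_top⟩ (top_le_iff.1 hle)

lemma ae_infinitelyRed [IsProbabilityMeasure μ] (h : IsCompensated μ r φ ε) :
    ∀ᵐ s ∂μ, InfinitelyRed (r s) := by
  have hfin : ∀ᵐ s ∂μ, ∀ j : ℕ, {k | reds (r s) k ∈ Set.Iic j}.Finite :=
    ae_all_iff.2 fun j => ae_finite_setOfPred_mem (h.tsum_measure_reds_ne_top j)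
  filter_upwards [hfin] with s hs
  refine infinitelyRed_of_forall_exists_lt_reds fun j => ?_
  obtain ⟨k, hk⟩ := (hs j).exists_notMem
  exact ⟨k, not_le.1 hk⟩

lemma tsum_lintegral_rate [IsProbabilityMeasure μ] (h : IsCompensated μ r φ ε) (j : ℕ) :
    ∑' k, ∫⁻ s in {s | reds (r s) k ∈ Set.Iic j}, ENNReal.ofReal (φ k s) ∂μ = j + 1 := by
  calc _ = ∑' k, μ {s | reds (r s) k ∈ Set.Iic j ∧ r s k = true} :=
        tsum_congr fun k => (h.measure_draw true k _).symm
    _ = ∫⁻ _, (j + 1 : ℝ≥0∞) ∂μ := by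
        rw [← h.lintegral_tsum_ite]
        exact lintegral_congr_ae (h.ae_infinitelyRed.mono fun s hs => tsum_ite_reds_le_and_red hs j)
    _ = j + 1 := by rw [lintegral_const, measure_univ, mul_one]

lemma tsum_lintegral_one_sub_rate [IsProbabilityMeasure μ] (h : IsCompensated μ r φ ε) (j : ℕ) :
    ∑' k, ∫⁻ s in {s | reds (r s) k ∈ Set.Iic j}, ENNReal.ofReal (1 - φ k s) ∂μ =
      ∫⁻ s, (failures (r s) j : ℝ≥0∞) ∂μ := by
  calc _ = ∑' k, μ {s | reds (r s) k ∈ Set.Iic j ∧ r s k = false} :=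
        tsum_congr fun k => (h.measure_draw false k _).symm
    _ = ∫⁻ s, (failures (r s) j : ℝ≥0∞) ∂μ := by
        rw [← h.lintegral_tsum_ite]
        exact lintegral_congr_ae
          (h.ae_infinitelyRed.mono fun s hs => tsum_ite_reds_le_and_not_red hs j)

lemma lintegral_failures_add [IsProbabilityMeasure μ] (h : IsCompensated μ r φ ε) (j : ℕ) :
    ∫⁻ s, (failures (r s) j : ℝ≥0∞) ∂μ +
        ∑' k, ∫⁻ s in {s | reds (r s) k ∈ Set.Iic j}, ENNReal.ofReal (2 * φ k s - 1) ∂μ =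
      j + 1 +
        ∑' k, ∫⁻ s in {s | reds (r s) k ∈ Set.Iic j}, ENNReal.ofReal (-(2 * φ k s - 1)) ∂μ := by
  rw [← h.tsum_lintegral_one_sub_rate, ← h.tsum_lintegral_rate, ← ENNReal.tsum_add,
    ← ENNReal.tsum_add]
  refine tsum_congr fun k => ?_
  have hm := h.measurable_rate k
  rw [← lintegral_add_left (by fun_prop), ← lintegral_add_left (by fun_prop)]
  refine lintegral_congr fun s => ?_
  have h0 : 0 ≤ φ k s := h.pos.le.trans (h.le_rate k s)
  have h1 := h.rate_le k s
  rcases le_total 0 (2 * φ k s - 1) with hs | hs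
  · rw [ENNReal.ofReal_of_nonpos (neg_nonpos.2 hs), add_zero,
      ← ENNReal.ofReal_add (by linarith) hs]
    congr 1
    ring
  · rw [ENNReal.ofReal_of_nonpos hs, add_zero, ← ENNReal.ofReal_add h0 (by linarith)]
    congr 1
    ring

lemma lintegral_failures_add_le [IsProbabilityMeasure μ] (h : IsCompensated μ r φ ε) {K j : ℕ}
    (hK : K ≤ j + 1) :
    ∫⁻ s, (failures (r s) j : ℝ≥0∞) ∂μ +
        ∑ k ∈ Finset.range K, ∫⁻ s, ENNReal.ofReal (2 * φ k s - 1) ∂μ ≤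
      j + (1 + ∑' k, ∫⁻ s, ENNReal.ofReal (-(2 * φ k s - 1)) ∂μ) := by
  have hpos : ∑ k ∈ Finset.range K, ∫⁻ s, ENNReal.ofReal (2 * φ k s - 1) ∂μ ≤
      ∑' k, ∫⁻ s in {s | reds (r s) k ∈ Set.Iic j}, ENNReal.ofReal (2 * φ k s - 1) ∂μ := by
    refine (Finset.sum_le_sum fun k hk => ?_).trans (ENNReal.sum_le_tsum (Finset.range K))
    have huniv : {s | reds (r s) k ∈ Set.Iic j} = Set.univ :=
      Set.eq_univ_of_forall fun s => (reds_le (r s) k).trans (by grind)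
    rw [huniv, setLIntegral_univ]
  calc _ ≤ _ := add_le_add_right hpos _
    _ = _ := h.lintegral_failures_add j
    _ ≤ _ := by
      rw [add_assoc]
      gcongr
      exact Measure.restrict_le_self

lemma exists_lintegral_failures_le [IsProbabilityMeasure μ] (h : IsCompensated μ r φ ε)
    (hd : 1 + ∑' k, ∫⁻ s, ENNReal.ofReal (-(2 * φ k s - 1)) ∂μ <
      ∑' k, ∫⁻ s, ENNReal.ofReal (2 * φ k s - 1) ∂μ) :
    ∃ (K : ℕ) (η C : ℝ≥0∞), 0 < η ∧ η ≠ ⊤ ∧ C ≠ ⊤ ∧ ∀ j : ℕ,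
      ∫⁻ s, (failures (r s) j : ℝ≥0∞) ∂μ + η ≤ j + if j < K then C else 0 := by
  set N := 1 + ∑' k, ∫⁻ s, ENNReal.ofReal (-(2 * φ k s - 1)) ∂μ
  obtain ⟨θ, hNθ, hθ⟩ := exists_between hd
  have hNtop : N ≠ ⊤ := hNθ.ne_top
  have hη : θ - N + N = θ := tsub_add_cancel_of_le hNθ.le
  obtain ⟨K, hK⟩ : ∃ K, θ < ∑ k ∈ Finset.range K, ∫⁻ s, ENNReal.ofReal (2 * φ k s - 1) ∂μ :=
    ((ENNReal.tendsto_nat_tsum _).eventually (lt_mem_nhds hθ)).exists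
  refine ⟨K, θ - N, θ, tsub_pos_of_lt hNθ, ENNReal.sub_ne_top hθ.ne_top, hθ.ne_top, fun j => ?_⟩
  split_ifs with hj
  · have hle : ∫⁻ s, (failures (r s) j : ℝ≥0∞) ∂μ ≤ j + N := by
      simpa only [Finset.range_zero, Finset.sum_empty, add_zero] using
        h.lintegral_failures_add_le (Nat.zero_le (j + 1))
    calc _ ≤ j + N + (θ - N) := add_le_add_left hle _
      _ = j + θ := by rw [add_assoc, add_comm N, hη]
  · refine (ENNReal.add_le_add_iff_right hNtop).1 ?_
    calc _ = ∫⁻ s, (failures (r s) j : ℝ≥0∞) ∂μ + θ := by rw [add_assoc, hη]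
      _ ≤ _ := add_le_add_right hK.le _
      _ ≤ j + N := h.lintegral_failures_add_le (by omega)
      _ = j + 0 + N := by rw [add_zero]

end IsCompensated

/-! ### The backward chain of left crossings -/

section Backward

/-- `backward b n i` is the number of jumps from `i` to `i - 1` before the level `i + n` is reached
from the left, for a walk which follows the draws `b` and is sent back to `i` from `i - 1`. -/
noncomputable def backward (b : ℕ → ℕ → Bool) : ℕ → ℕ → ℕ
  | 0, _ => 0
  | n + 1, i => failures (b i) (backward b n (i + 1))

lemma backward_mono {b : ℕ → ℕ → Bool} (hb : ∀ i, InfinitelyRed (b i)) (i : ℕ) :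
    Monotone fun n => backward b n i := by
  refine monotone_nat_of_le_succ fun n => ?_
  induction n generalizing i with
  | zero => exact Nat.zero_le _
  | succ n ih => exact failures_mono (hb i) (ih (i + 1))

lemma measurable_backward_generatedBy {Ω : Type*} (B : ℕ → Ω → ℕ → Bool) (n i : ℕ) :
    Measurable[generatedBy B (Set.Ici i)] fun ω => backward (fun k => B k ω) n i := by
  induction n generalizing i with
  | zero => exact @measurable_const _ _ _ _ _
  | succ n ih =>
    have htail := (ih (i + 1)).mono (generatedBy_mono (Set.Ici_subset_Ici.2 i.le_succ)) le_rfl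
    exact measurable_failures.comp ((measurable_generatedBy Set.self_mem_Ici).prodMk htail)

variable {Ω : Type*} [mΩ : MeasurableSpace Ω] {P : Measure Ω} {B : ℕ → Ω → ℕ → Bool}

lemma measurable_backward (hB : ∀ i, Measurable (B i)) (n i : ℕ) :
    Measurable fun ω => backward (fun k => B k ω) n i :=
  (measurable_backward_generatedBy B n i).mono (generatedBy_le hB) le_rfl

lemma lintegral_backward_eq (hB : ∀ i, Measurable (B i)) (n i : ℕ) (F : ℕ → ℝ≥0∞) :
    ∫⁻ ω, F (backward (fun k => B k ω) n i) ∂P =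
      ∫⁻ j, F j ∂(P.map fun ω => backward (fun k => B k ω) n i) :=
  (lintegral_map (measurable_of_countable F) (measurable_backward hB n i)).symm

lemma indepFun_backward (hB : ∀ i, Measurable (B i)) (hind : iIndepFun B P) (n i : ℕ) :
    IndepFun (B i) (fun ω => backward (fun k => B k ω) n (i + 1)) P :=
  indepFun_of_disjoint hB hind (Set.disjoint_singleton_left.2 (by simp))
    (measurable_generatedBy (Set.mem_singleton i)) (measurable_backward_generatedBy B n (i + 1))

variable [IsProbabilityMeasure P] {ν : Measure (ℕ → Bool)}

lemma map_prodMk_backward (hB : ∀ i, Measurable (B i)) (hind : iIndepFun B P)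
    (hlaw : ∀ i, P.map (B i) = ν) (n i : ℕ) :
    P.map (fun ω => (B i ω, backward (fun k => B k ω) n (i + 1))) =
      ν.prod (P.map fun ω => backward (fun k => B k ω) n (i + 1)) := by
  rw [(indepFun_iff_map_prod_eq_prod_map_map (hB i).aemeasurable
    (measurable_backward hB n (i + 1)).aemeasurable).1 (indepFun_backward hB hind n i), hlaw]

lemma map_backward_succ (hB : ∀ i, Measurable (B i)) (hind : iIndepFun B P)
    (hlaw : ∀ i, P.map (B i) = ν) (n i : ℕ) :
    (P.map fun ω => backward (fun k => B k ω) (n + 1) i) =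
      (ν.prod (P.map fun ω => backward (fun k => B k ω) n (i + 1))).map
        fun q => failures q.1 q.2 := by
  rw [← map_prodMk_backward hB hind hlaw, Measure.map_map measurable_failures
    ((hB i).prodMk (measurable_backward hB n (i + 1)))]
  rfl

lemma map_backward_eq (hB : ∀ i, Measurable (B i)) (hind : iIndepFun B P)
    (hlaw : ∀ i, P.map (B i) = ν) (n i i' : ℕ) :
    (P.map fun ω => backward (fun k => B k ω) n i) =
      P.map fun ω => backward (fun k => B k ω) n i' := by
  induction n generalizing i i' with
  | zero => rfl
  | succ n ih =>
    rw [map_backward_succ hB hind hlaw, map_backward_succ hB hind hlaw, ih (i + 1) (i' + 1)]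

lemma measure_backward_lt_eq (hB : ∀ i, Measurable (B i)) (hind : iIndepFun B P)
    (hlaw : ∀ i, P.map (B i) = ν) (n i i' K : ℕ) :
    P {ω | backward (fun k => B k ω) n i < K} = P {ω | backward (fun k => B k ω) n i' < K} := by
  have h := congrArg (fun m => m (Set.Iio K)) (map_backward_eq hB hind hlaw n i i')
  simp only [Measure.map_apply (measurable_backward hB _ _) measurableSet_Iio] at h
  exact h

lemma lintegral_backward_succ [SFinite ν] (hB : ∀ i, Measurable (B i)) (hind : iIndepFun B P)
    (hlaw : ∀ i, P.map (B i) = ν) (n i : ℕ) :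
    ∫⁻ ω, (backward (fun k => B k ω) (n + 1) i : ℝ≥0∞) ∂P =
      ∫⁻ ω, ∫⁻ b, (failures b (backward (fun k => B k ω) n i) : ℝ≥0∞) ∂ν ∂P := by
  have hcast : Measurable fun q : (ℕ → Bool) × ℕ => (failures q.1 q.2 : ℝ≥0∞) :=
    (measurable_of_countable (fun n : ℕ => (n : ℝ≥0∞))).comp measurable_failures
  rw [lintegral_backward_eq hB n i fun j => ∫⁻ b, (failures b j : ℝ≥0∞) ∂ν,
    map_backward_eq hB hind hlaw n i (i + 1),
    lintegral_backward_eq hB (n + 1) i fun j => (j : ℝ≥0∞), map_backward_succ hB hind hlaw,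
    lintegral_map (measurable_of_countable _) measurable_failures, lintegral_prod_symm' _ hcast]

-- If the gains `C * a n` stayed below `η / 2`, then `e` would drop by `η / 2` forever.
lemma exists_frequently_le_of_add_le {e a : ℕ → ℝ≥0∞} {η C : ℝ≥0∞} (hη : 0 < η) (hηtop : η ≠ ⊤)
    (hC : C ≠ ⊤) (he : e 0 ≠ ⊤) (ha : ∀ n, a n ≠ ⊤)
    (hstep : ∀ n, e (n + 1) + η ≤ e n + C * a n) :
    ∃ c : ℝ≥0∞, 0 < c ∧ ∃ᶠ n in atTop, c ≤ a n := by
  have hhalf : 0 < η / 2 := ENNReal.half_pos hη.ne'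
  have hfin : ∀ n, e n ≠ ⊤ := fun n => by
    induction n with
    | zero => exact he
    | succ n ih =>
      exact ne_top_of_le_ne_top (ENNReal.add_ne_top.2 ⟨ih, ENNReal.mul_ne_top hC (ha n)⟩)
        (le_self_add.trans (hstep n))
  refine ⟨η / 2 / (C + 1), ENNReal.div_pos hhalf.ne' (ENNReal.add_ne_top.2
    ⟨hC, ENNReal.one_ne_top⟩), fun hcon => ?_⟩
  obtain ⟨n₀, hn₀⟩ := eventually_atTop.1 hcon
  have hdec : ∀ n ≥ n₀, e (n + 1) + η / 2 ≤ e n := fun n hn => by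
    have hgain : C * a n ≤ η / 2 :=
      (mul_le_mul' le_self_add (not_le.1 (hn₀ n hn)).le).trans ENNReal.mul_div_le
    refine (ENNReal.add_le_add_iff_right (ENNReal.div_ne_top hηtop two_ne_zero)).1 ?_
    rw [add_assoc, ENNReal.add_halves]
    exact (hstep n).trans (add_le_add_right hgain _)
  have hsum : ∀ m : ℕ, e (n₀ + m) + m * (η / 2) ≤ e n₀ := fun m => by
    induction m with
    | zero => simp
    | succ m ih =>
      calc e (n₀ + m + 1) + (m + 1 : ℕ) * (η / 2)
          = e (n₀ + m + 1) + η / 2 + m * (η / 2) := by push_cast; ring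
        _ ≤ e (n₀ + m) + m * (η / 2) := add_le_add_left (hdec _ (Nat.le_add_right _ _)) _
        _ ≤ e n₀ := ih
  obtain ⟨m, hm⟩ := ENNReal.exists_nat_mul_gt hhalf.ne' (hfin n₀)
  exact hm.not_ge (le_add_self.trans (hsum m))

lemma exists_frequently_le_measure_backward [SFinite ν] (hB : ∀ i, Measurable (B i))
    (hind : iIndepFun B P) (hlaw : ∀ i, P.map (B i) = ν) {K : ℕ} {η C : ℝ≥0∞} (hη : 0 < η)
    (hηtop : η ≠ ⊤) (hC : C ≠ ⊤)
    (hdrift : ∀ j : ℕ, ∫⁻ b, (failures b j : ℝ≥0∞) ∂ν + η ≤ j + if j < K then C else 0) (i : ℕ) :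
    ∃ c : ℝ≥0∞, 0 < c ∧ ∃ᶠ n in atTop, c ≤ P {ω | backward (fun k => B k ω) n i < K} := by
  refine exists_frequently_le_of_add_le (e := fun n => ∫⁻ ω, backward (fun k => B k ω) n i ∂P) hη
    hηtop hC (by simp [backward]) (fun n => measure_ne_top _ _) fun n => ?_
  have hm := measurable_backward hB n i
  have hcast : Measurable fun ω => (backward (fun k => B k ω) n i : ℝ≥0∞) :=
    (measurable_of_countable fun j : ℕ => (j : ℝ≥0∞)).comp hm
  have hconst : C * P {ω | backward (fun k => B k ω) n i < K} =
      ∫⁻ ω, (if backward (fun k => B k ω) n i < K then C else 0) ∂P := by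
    rw [← lintegral_indicator_const (measurableSet_lt hm measurable_const)]
    exact lintegral_congr fun ω => by simp [Set.indicator_apply]
  calc _ = ∫⁻ ω, (∫⁻ b, (failures b (backward (fun k => B k ω) n i) : ℝ≥0∞) ∂ν + η) ∂P := by
        rw [lintegral_backward_succ hB hind hlaw, lintegral_add_right _ measurable_const,
          lintegral_const, measure_univ, mul_one]
    _ ≤ ∫⁻ ω, ((backward (fun k => B k ω) n i : ℝ≥0∞) +
          if backward (fun k => B k ω) n i < K then C else 0) ∂P :=
        lintegral_mono fun ω => hdrift _
    _ = _ := by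
        rw [hconst, lintegral_add_left hcast]

lemma mul_measure_backward_lt_le (hB : ∀ i, Measurable (B i)) (hind : iIndepFun B P)
    (hlaw : ∀ i, P.map (B i) = ν) (n i K : ℕ) :
    ν {b | reds b K = K} * P {ω | backward (fun k => B k ω) n i < K} ≤
      P {ω | backward (fun k => B k ω) (n + 1) i = 0} := by
  calc _ = P (B i ⁻¹' {b | reds b K = K}) *
        P ((fun ω => backward (fun k => B k ω) n (i + 1)) ⁻¹' Set.Iio K) := by
        rw [← hlaw i, Measure.map_apply (hB i) (measurableSet_reds_eq K K),
          measure_backward_lt_eq hB hind hlaw n i (i + 1)]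
        rfl
    _ = P (B i ⁻¹' {b | reds b K = K} ∩
        (fun ω => backward (fun k => B k ω) n (i + 1)) ⁻¹' Set.Iio K) :=
        ((indepFun_backward hB hind n i).measure_inter_preimage_eq_mul _ _
          (measurableSet_reds_eq K K) measurableSet_Iio).symm
    _ ≤ _ := measure_mono fun ω hω => failures_eq_zero hω.1 hω.2

lemma le_measure_forall_backward_eq_zero (hB : ∀ i, Measurable (B i))
    (hinf : ∀ᵐ ω ∂P, ∀ i, InfinitelyRed (B i ω)) {i : ℕ} {c : ℝ≥0∞}
    (hc : ∃ᶠ n in atTop, c ≤ P {ω | backward (fun k => B k ω) (n + 1) i = 0}) :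
    c ≤ P {ω | ∀ n, backward (fun k => B k ω) n i = 0} := by
  have hm : ∀ n, MeasurableSet {ω | backward (fun k => B k ω) (n + 1) i = 0} := fun n =>
    measurableSet_eq_fun (measurable_backward hB (n + 1) i) measurable_const
  refine (le_measure_limsup hm hc).trans (measure_mono_ae ?_)
  filter_upwards [hinf] with ω hω hlimsup n
  obtain ⟨m, hnm, hm0⟩ := frequently_atTop.1 (mem_limsup_iff_frequently_mem.1 hlimsup) n
  exact Nat.le_zero.1 ((backward_mono hω i (hnm.trans m.le_succ)).trans_eq hm0)

theorem ae_exists_forall_backward_eq_zero [SFinite ν] (hB : ∀ i, Measurable (B i))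
    (hind : iIndepFun B P) (hlaw : ∀ i, P.map (B i) = ν)
    (hinf : ∀ᵐ ω ∂P, ∀ i, InfinitelyRed (B i ω)) (hred : ∀ K : ℕ, 0 < ν {b | reds b K = K})
    {K : ℕ} {η C : ℝ≥0∞} (hη : 0 < η) (hηtop : η ≠ ⊤) (hC : C ≠ ⊤)
    (hdrift : ∀ j : ℕ, ∫⁻ b, (failures b j : ℝ≥0∞) ∂ν + η ≤ j + if j < K then C else 0) :
    ∀ᵐ ω ∂P, ∃ i, ∀ n, backward (fun k => B k ω) n i = 0 := by
  obtain ⟨c, hc, hfreq⟩ :=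
    exists_frequently_le_measure_backward hB hind hlaw hη hηtop hC hdrift 0
  have htail : ∀ i, MeasurableSet[generatedBy B (Set.Ici i)]
      {ω | ∀ n, backward (fun k => B k ω) n i = 0} := fun i => by
    rw [Set.ofPred_forall]
    exact MeasurableSet.iInter fun n =>
      measurable_backward_generatedBy B n i (measurableSet_singleton 0)
  refine (ae_frequently_mem_of_le_measure hB hind htail
    (ENNReal.mul_pos (hred K).ne' hc.ne') fun i => ?_).mono fun ω hω => hω.exists
  refine le_measure_forall_backward_eq_zero hB hinf (hfreq.mono fun n hn => ?_)
  rw [measure_backward_lt_eq hB hind hlaw n 0 i] at hn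
  exact (mul_le_mul_right hn _).trans (mul_measure_backward_lt_le hB hind hlaw n i K)

end Backward

lemma IsCompensated.ae_exists_forall_backward_eq_zero {S Ω : Type*} [MeasurableSpace S]
    [MeasurableSpace Ω] {μ : Measure S} [IsProbabilityMeasure μ] {P : Measure Ω}
    [IsProbabilityMeasure P] {r : S → ℕ → Bool} {φ : ℕ → S → ℝ} {ε : ℝ}
    (h : IsCompensated μ r φ ε)
    (hd : 1 + ∑' k, ∫⁻ s, ENNReal.ofReal (-(2 * φ k s - 1)) ∂μ <
      ∑' k, ∫⁻ s, ENNReal.ofReal (2 * φ k s - 1) ∂μ)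
    {X : ℕ → Ω → S} (hX : ∀ i, Measurable (X i)) (hind : iIndepFun X P)
    (hlaw : ∀ i, P.map (X i) = μ) :
    ∀ᵐ ω ∂P, (∀ i, InfinitelyRed (r (X i ω))) ∧
      ∃ i, ∀ n, backward (fun k => r (X k ω)) n i = 0 := by
  obtain ⟨K, η, C, hη, hηtop, hC, hdrift⟩ := h.exists_lintegral_failures_le hd
  have hr := h.measurable_draw
  have hinf : ∀ᵐ ω ∂P, ∀ i, InfinitelyRed (r (X i ω)) := ae_all_iff.2 fun i =>
    ae_of_ae_map (hX i).aemeasurable ((hlaw i).symm ▸ h.ae_infinitelyRed)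
  refine hinf.and (RRW.ae_exists_forall_backward_eq_zero (ν := μ.map r) (B := fun i ω => r (X i ω))
    (K := K) (fun i => hr.comp (hX i)) (hind.comp (fun _ => r) fun _ => hr) (fun i => ?_) hinf
    (fun k => ?_) hη hηtop hC fun j => ?_)
  · rw [← hlaw i, Measure.map_map hr (hX i)]
    rfl
  · rw [Measure.map_apply hr (measurableSet_reds_eq k k)]
    exact h.measure_reds_eq_pos k
  · have hm : Measurable fun b : ℕ → Bool => (failures b j : ℝ≥0∞) :=
      (measurable_of_countable fun n : ℕ => (n : ℝ≥0∞)).comp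
        (measurable_failures.comp (measurable_id.prodMk measurable_const))
    rw [lintegral_map hm hr]
    exact hdrift j

/-! ### Walks driven by draws -/

/-- `pos` is a nearest neighbour walk on `ℤ` with local times `loc`, started at `0`, which consumes
the draws `b x` one by one at its visits to `x` and jumps to the right exactly when the draw is
Red. -/
structure IsDrivenWalk (b : ℤ → ℕ → Bool) (pos : ℕ → ℤ) (loc : ℕ → ℤ → ℕ) : Prop where
  pos_zero : pos 0 = 0
  loc_zero : ∀ x, loc 0 x = 0
  pos_succ : ∀ n, pos (n + 1) =
    if b (pos n) (loc n (pos n)) = true then pos n + 1 else pos n - 1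
  loc_succ : ∀ n, loc (n + 1) = Function.update (loc n) (pos n) (loc n (pos n) + 1)

namespace IsDrivenWalk

variable {b : ℤ → ℕ → Bool} {pos : ℕ → ℤ} {loc : ℕ → ℤ → ℕ}

lemma neg (h : IsDrivenWalk b pos loc) :
    IsDrivenWalk (fun x k => !b (-x) k) (fun n => -pos n) (fun n x => loc n (-x)) where
  pos_zero := by rw [h.pos_zero, neg_zero]
  loc_zero x := h.loc_zero (-x)
  pos_succ n := by
    rw [h.pos_succ, neg_neg]
    cases b (pos n) (loc n (pos n)) <;> simp [neg_add', neg_add_eq_sub, -neg_add_rev]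
  loc_succ n := by
    funext x
    simp only [h.loc_succ, Function.update_apply, neg_neg, neg_eq_iff_eq_neg]

lemma monotone_loc (h : IsDrivenWalk b pos loc) (x : ℤ) : Monotone fun n => loc n x := by
  refine monotone_nat_of_le_succ fun n => ?_
  rw [h.loc_succ, Function.update_apply]
  split_ifs with hx
  · exact hx ▸ Nat.le_succ _
  · exact le_rfl

lemma pos_le (h : IsDrivenWalk b pos loc) (n : ℕ) : pos n ≤ n := by
  induction n with
  | zero => exact h.pos_zero.le
  | succ n ih =>
    rw [h.pos_succ]
    split_ifs <;> omega

lemma loc_eq_zero (h : IsDrivenWalk b pos loc) {n : ℕ} {x : ℤ} (hx : (n : ℤ) ≤ x) :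
    loc n x = 0 := by
  induction n with
  | zero => exact h.loc_zero x
  | succ n ih =>
    have := h.pos_le n
    rw [h.loc_succ, Function.update_of_ne (by omega)]
    exact ih (by omega)

/-- The crossings of an edge alternate: as the walk starts on the left of the edge, it has crossed
it once more to the right than to the left when it stands on the right of it. -/
lemma reds_loc_eq (h : IsDrivenWalk b pos loc) (n : ℕ) {x : ℤ} (hx : 0 ≤ x) :
    reds (b x) (loc n x) =
      (loc n (x + 1) - reds (b (x + 1)) (loc n (x + 1))) + if x < pos n then 1 else 0 := by
  induction n with
  | zero => simp only [h.loc_zero, h.pos_zero, reds_zero, if_neg (not_lt.2 hx)]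
  | succ n ih =>
    have hle := reds_le (b (x + 1)) (loc n (x + 1))
    rw [h.loc_succ, h.pos_succ]
    by_cases hn : x = pos n
    · subst hn
      rw [Function.update_self, Function.update_of_ne (by omega), reds_succ]
      simp only [lt_irrefl, if_false] at ih
      split_ifs <;> omega
    by_cases hn' : x + 1 = pos n
    · rw [Function.update_of_ne hn, hn', Function.update_self, reds_succ]
      rw [hn'] at ih hle
      split_ifs at ih ⊢ <;> omega
    · rw [Function.update_of_ne hn, Function.update_of_ne hn']
      split_ifs at ih ⊢ <;> omega

lemma loc_sub_reds_le_backward (h : IsDrivenWalk b pos loc)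
    (hinf : ∀ i : ℕ, InfinitelyRed (b (i + 1))) {t i n : ℕ} (hpos : pos t ≤ i)
    (hn : t ≤ i + 1 + n) :
    loc t (i + 1) - reds (b (i + 1)) (loc t (i + 1)) ≤
      backward (fun k : ℕ => b (k + 1)) n i := by
  induction n generalizing i with
  | zero => exact (Nat.sub_le _ _).trans (h.loc_eq_zero (by omega)).le
  | succ n ih =>
    have hnext := ih (i := i + 1) (by omega) (by omega)
    have hflow := h.reds_loc_eq t (x := i + 1) (by omega)
    rw [if_neg (by omega), add_zero] at hflow
    push_cast at hnext
    exact sub_reds_le_failures (hinf i) (hflow.trans_le hnext)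

lemma exists_backward_ne_zero (h : IsDrivenWalk b pos loc)
    (hinf : ∀ i : ℕ, InfinitelyRed (b (i + 1))) (hrec : ∀ x, ∃ᶠ n in atTop, pos n = x) (i : ℕ) :
    ∃ n, backward (fun k : ℕ => b (k + 1)) n i ≠ 0 := by
  obtain ⟨s, -, hs⟩ := frequently_atTop.1 (hrec (i + 1)) 0
  obtain ⟨t, hst, ht⟩ := frequently_atTop.1 (hrec i) s
  refine ⟨t, fun hzero => ?_⟩
  have hleft := (h.loc_sub_reds_le_backward hinf ht.le (by omega)).trans_eq hzero
  have hflow_s := h.reds_loc_eq s (x := i) (by omega)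
  have hflow_t := h.reds_loc_eq t (x := i) (by omega)
  have hreds : reds (b i) (loc s i) ≤ reds (b i) (loc t i) :=
    reds_mono (b i) (h.monotone_loc i hst)
  rw [if_pos (by omega)] at hflow_s
  rw [if_neg (by omega)] at hflow_t
  omega

end IsDrivenWalk

/-! ### A single urn -/

section Urn

/-- The law of the sequence of independent uniform numbers that drives one urn. -/
noncomputable def drawMeasure : Measure (ℕ → unitInterval) :=
  Measure.infinitePi fun _ : ℕ => (volume : Measure unitInterval)

instance : IsProbabilityMeasure drawMeasure := by
  unfold drawMeasure
  infer_instance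

/-- The sequence of draws of an urn, `true` standing for Red. -/
noncomputable def draws (f : ℝ → ℝ) (s : UrnState) (u : ℕ → unitInterval) (k : ℕ) : Bool :=
  decide ((u k : ℝ) < f (urn f s u k).1)

/-- The admissible states of an urn. -/
def IsUrnState (s : UrnState) : Prop := s.1 ∈ Set.Icc (0 : ℝ) 1 ∧ 0 < s.2

/-- The state after a quantity `h` of Red and `1 - h` of the other colour are added to the urn: the
draws are the cases `h = 1` and `h = 0`. -/
noncomputable def addBall (h : ℝ) (s : UrnState) : UrnState :=
  ((s.2 * s.1 + h) / (s.2 + 1), s.2 + 1)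

/-- The σ-algebra of the first `k` numbers that drive the urn. -/
abbrev past (k : ℕ) : MeasurableSpace (ℕ → unitInterval) :=
  generatedBy (fun (i : ℕ) (u : ℕ → unitInterval) => u i) (Set.Iio k)

variable {f : ℝ → ℝ} {s : UrnState}

lemma urnStep_eq (f : ℝ → ℝ) (v : unitInterval) (s : UrnState) :
    urnStep f v s = addBall (if (v : ℝ) < f s.1 then 1 else 0) s := by
  unfold urnStep addBall
  split_ifs <;> simp only [add_zero]

lemma IsUrnState.addBall (hs : IsUrnState s) {h : ℝ} (hh : h ∈ Set.Icc (0 : ℝ) 1) :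
    IsUrnState (addBall h s) := by
  obtain ⟨⟨h0, h1⟩, hl⟩ := hs
  have hmul : s.2 * s.1 ≤ s.2 := mul_le_of_le_one_right hl.le h1
  have hl1 : 0 < s.2 + 1 := by linarith
  exact ⟨⟨div_nonneg (add_nonneg (mul_nonneg hl.le h0) hh.1) hl1.le,
    (div_le_one hl1).2 (add_le_add hmul hh.2)⟩, hl1⟩

lemma IsUrnState.urn (hs : IsUrnState s) (f : ℝ → ℝ) (u : ℕ → unitInterval) (k : ℕ) :
    IsUrnState (urn f s u k) := by
  induction k with
  | zero => exact hs
  | succ k ih =>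
    rw [RRW.urn, urnStep_eq]
    exact ih.addBall (by split_ifs <;> simp)

lemma urn_snd (f : ℝ → ℝ) (s : UrnState) (u : ℕ → unitInterval) (k : ℕ) :
    (urn f s u k).2 = s.2 + k := by
  induction k with
  | zero => simp [urn]
  | succ k ih =>
    rw [urn, urnStep_eq, addBall, ih]
    push_cast
    ring

lemma measurable_addBall (h : ℝ) : Measurable (addBall h) := by
  unfold addBall
  fun_prop

lemma measurable_urnStep (hf : Measurable f) :
    Measurable fun q : UrnState × unitInterval => urnStep f q.2 q.1 := by
  unfold urnStep
  refine Measurable.ite (measurableSet_lt (by fun_prop) (by fun_prop)) ?_ ?_ <;> fun_prop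

lemma past_mono : Monotone past := fun _ _ h => generatedBy_mono (Set.Iio_subset_Iio h)

lemma past_le (k : ℕ) : past k ≤ MeasurableSpace.pi :=
  generatedBy_le measurable_pi_apply

lemma measurable_past_succ (k : ℕ) : Measurable[past (k + 1)] fun u : ℕ → unitInterval => u k :=
  measurable_generatedBy (Set.mem_Iio.2 k.lt_succ_self)

lemma measurable_past_urn (hf : Measurable f) (s : UrnState) (k : ℕ) :
    Measurable[past k] fun u => urn f s u k := by
  induction k with
  | zero => exact @measurable_const _ _ _ _ _
  | succ k ih =>
    exact (measurable_urnStep hf).comp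
      ((ih.mono (past_mono k.le_succ) le_rfl).prodMk (measurable_past_succ k))

lemma measurable_urn (hf : Measurable f) (s : UrnState) (k : ℕ) :
    Measurable fun u => urn f s u k :=
  (measurable_past_urn hf s k).mono (past_le k) le_rfl

lemma measurable_decide_lt (hf : Measurable f) :
    Measurable fun q : UrnState × unitInterval => decide ((q.2 : ℝ) < f q.1.1) := by
  refine measurable_to_bool ?_
  simp only [Set.preimage, Set.mem_singleton_iff, decide_eq_true_eq]
  exact measurableSet_lt (by fun_prop) (by fun_prop)

lemma measurable_past_draws (hf : Measurable f) (s : UrnState) (k : ℕ) :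
    Measurable[past (k + 1)] fun u => draws f s u k :=
  (measurable_decide_lt hf).comp
    (((measurable_past_urn hf s k).mono (past_mono k.le_succ) le_rfl).prodMk
      (measurable_past_succ k))

lemma measurable_draws (hf : Measurable f) (s : UrnState) : Measurable (draws f s) :=
  measurable_pi_lambda _ fun k => (measurable_past_draws hf s k).mono (past_le _) le_rfl

lemma measurable_past_reds_draws (hf : Measurable f) (s : UrnState) (k : ℕ) :
    Measurable[past k] fun u => reds (draws f s u) k := by
  induction k with
  | zero => exact @measurable_const _ _ _ _ _
  | succ k ih =>
    simp only [reds_succ]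
    have hite : Measurable fun q : ℕ × Bool => q.1 + if q.2 = true then 1 else 0 :=
      measurable_of_countable _
    exact hite.comp
      ((ih.mono (past_mono k.le_succ) le_rfl).prodMk (measurable_past_draws hf s k))

lemma lintegral_past_next {β : Type*} [MeasurableSpace β] {k : ℕ} {Y : (ℕ → unitInterval) → β}
    (hY : Measurable[past k] Y) {F : β × unitInterval → ℝ≥0∞} (hF : Measurable F) :
    ∫⁻ u, F (Y u, u k) ∂drawMeasure = ∫⁻ u, ∫⁻ v, F (Y u, v) ∂volume ∂drawMeasure := by
  have hYm : Measurable Y := hY.mono (past_le k) le_rfl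
  have hind : IndepFun Y (fun u : ℕ → unitInterval => u k) drawMeasure :=
    indepFun_of_disjoint (T' := {k}) measurable_pi_apply
      (iIndepFun_infinitePi (X := fun _ v => v) fun _ => measurable_id) (by simp) hY
      (measurable_generatedBy (Set.mem_singleton k))
  have hlaw : drawMeasure.map (fun u => u k) = volume := Measure.infinitePi_map_eval _ k
  have hprod : drawMeasure.map (fun u => (Y u, u k)) = (drawMeasure.map Y).prod volume := by
    rw [(indepFun_iff_map_prod_eq_prod_map_map hYm.aemeasurable
      (measurable_pi_apply k).aemeasurable).1 hind, hlaw]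
  rw [← lintegral_map hF (hYm.prodMk (measurable_pi_apply k)), hprod,
    lintegral_prod _ hF.aemeasurable, lintegral_map hF.lintegral_prod_right' hYm]

lemma lintegral_ite_lt {c : ℝ} (hc : c ∈ Set.Icc (0 : ℝ) 1) (A B : ℝ≥0∞) :
    ∫⁻ v : unitInterval, (if (v : ℝ) < c then A else B) =
      ENNReal.ofReal c * A + ENNReal.ofReal (1 - c) * B := by
  have hm : MeasurableSet {v : unitInterval | (v : ℝ) < c} :=
    measurableSet_lt (by fun_prop) (by fun_prop)
  have hvol : volume {v : unitInterval | (v : ℝ) < c} = ENNReal.ofReal c :=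
    unitInterval.volume_Iio (⟨c, hc⟩ : unitInterval)
  have hvol' : volume {v : unitInterval | (v : ℝ) < c}ᶜ = ENNReal.ofReal (1 - c) := by
    rw [prob_compl_eq_one_sub hm, hvol, ENNReal.ofReal_sub _ hc.1, ENNReal.ofReal_one]
  rw [← lintegral_add_compl _ hm,
    setLIntegral_congr_fun (g := fun _ => A) hm fun v (hv : (v : ℝ) < c) => if_pos hv,
    setLIntegral_congr_fun (g := fun _ => B) hm.compl fun v (hv : ¬(v : ℝ) < c) => if_neg hv,
    setLIntegral_const, setLIntegral_const, hvol, hvol', mul_comm A, mul_comm B]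

lemma lintegral_urn_succ (hf : Measurable f) (hf01 : ∀ t, f t ∈ Set.Icc (0 : ℝ) 1) (s : UrnState)
    {V : UrnState → ℝ≥0∞} (hV : Measurable V) (k : ℕ) :
    ∫⁻ u, V (urn f s u (k + 1)) ∂drawMeasure =
      ∫⁻ u, (ENNReal.ofReal (f (urn f s u k).1) * V (addBall 1 (urn f s u k)) +
        ENNReal.ofReal (1 - f (urn f s u k).1) * V (addBall 0 (urn f s u k))) ∂drawMeasure := by
  refine (lintegral_past_next (measurable_past_urn hf s k)
    (hV.comp (measurable_urnStep hf))).trans (lintegral_congr fun u => ?_)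
  rw [← lintegral_ite_lt (hf01 _)]
  refine lintegral_congr fun v => ?_
  simp only [Function.comp_apply, urnStep_eq]
  split_ifs <;> rfl

lemma lintegral_ite_decide_lt {x : ℝ} (hx : x ∈ Set.Icc (0 : ℝ) 1) (c : Bool) :
    ∫⁻ v : unitInterval, (if decide ((v : ℝ) < x) = c then (1 : ℝ≥0∞) else 0) =
      ENNReal.ofReal (bif c then x else 1 - x) := by
  cases c
  · simpa [← not_lt, ite_not] using lintegral_ite_lt hx 0 1
  · simpa using lintegral_ite_lt hx 1 0

theorem isCompensated_draws (hf : Measurable f) {ε : ℝ} (hε : 0 < ε) (hfε : ∀ t, ε ≤ f t)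
    (hf1 : ∀ t, f t ≤ 1) (s : UrnState) :
    IsCompensated drawMeasure (draws f s) (fun k u => f (urn f s u k).1) ε where
  measurable_draw := measurable_draws hf s
  measurable_rate k := by
    have := measurable_urn hf s k
    fun_prop
  pos := hε
  le_rate _ _ := hfε _
  rate_le _ _ := hf1 _
  measure_draw c k T := by
    classical
    have hT : MeasurableSet {u | reds (draws f s u) k ∈ T} :=
      ((measurable_reds k).comp (measurable_draws hf s)) (MeasurableSet.of_discrete (s := T))
    have hTc : MeasurableSet {u | reds (draws f s u) k ∈ T ∧ draws f s u k = c} :=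
      hT.inter (((measurable_pi_apply k).comp (measurable_draws hf s)) (measurableSet_singleton c))
    have hF : Measurable fun q : (ℕ × UrnState) × unitInterval =>
        if q.1.1 ∈ T then (if decide ((q.2 : ℝ) < f q.1.2.1) = c then (1 : ℝ≥0∞) else 0) else 0 :=
      Measurable.ite (measurable_fst.fst (MeasurableSet.of_discrete (s := T)))
        (Measurable.ite (((measurable_decide_lt hf).comp
          (measurable_fst.snd.prodMk measurable_snd)) (measurableSet_singleton c))
          measurable_const measurable_const) measurable_const
    have hnext := lintegral_past_next
      ((measurable_past_reds_draws hf s k).prodMk (measurable_past_urn hf s k)) hF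
    rw [← lintegral_indicator_one hTc, ← lintegral_indicator hT]
    refine Eq.trans (lintegral_congr fun u => ?_) (hnext.trans (lintegral_congr fun u => ?_))
    · simp [Set.indicator_apply, draws, ite_and]
    · by_cases hu : reds (draws f s u) k ∈ T
      · simp only [hu, if_true, Set.indicator_apply, Set.mem_ofPred_eq]
        exact lintegral_ite_decide_lt ⟨hε.le.trans (hfε _), hf1 _⟩ c
      · simp [hu]

end Urn

/-! ### Sums along the urn process -/

section MeanSum

variable {f : ℝ → ℝ} {s : UrnState} {g g₁ g₂ : UrnState → ℝ}

/-- The mean of the sum of the positive part of `g` along the urn process. -/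
noncomputable def meanSum (f : ℝ → ℝ) (s : UrnState) (g : UrnState → ℝ) : ℝ≥0∞ :=
  ∑' k, ∫⁻ u, ENNReal.ofReal (g (urn f s u k)) ∂drawMeasure

/-- The positive part of `g` is summable in mean along the urn process. -/
def MeanSummable (f : ℝ → ℝ) (s : UrnState) (g : UrnState → ℝ) : Prop :=
  meanSum f s g ≠ ⊤

lemma MeanSummable.mono (hs : IsUrnState s) (h₁ : MeanSummable f s g₁)
    (h : ∀ q, IsUrnState q → g q ≤ g₁ q) : MeanSummable f s g :=
  ne_top_of_le_ne_top h₁ (ENNReal.tsum_le_tsum fun k => lintegral_mono fun u =>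
    ENNReal.ofReal_le_ofReal (h _ (hs.urn f u k)))

lemma MeanSummable.add (hf : Measurable f) (hm : Measurable g₁) (h₁ : MeanSummable f s g₁)
    (h₂ : MeanSummable f s g₂) : MeanSummable f s fun q => g₁ q + g₂ q := by
  refine ne_top_of_le_ne_top (ENNReal.add_ne_top.2 ⟨h₁, h₂⟩) ?_
  unfold meanSum
  rw [← ENNReal.tsum_add]
  refine ENNReal.tsum_le_tsum fun k => ?_
  have hu := measurable_urn hf s k
  rw [← lintegral_add_left (by fun_prop)]
  exact lintegral_mono fun u => ENNReal.ofReal_add_le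

lemma MeanSummable.const_mul (h : MeanSummable f s g) {a : ℝ} (ha : 0 ≤ a) :
    MeanSummable f s fun q => a * g q := by
  simp only [MeanSummable, meanSum, ENNReal.ofReal_mul ha,
    lintegral_const_mul' _ _ ENNReal.ofReal_ne_top, ENNReal.tsum_mul_left]
  exact ENNReal.mul_ne_top ENNReal.ofReal_ne_top h

lemma MeanSummable.of_summable (hs : IsUrnState s) {a : ℕ → ℝ} (ha : Summable a)
    (h : ∀ (k : ℕ) (q : UrnState), k ≤ q.2 → g q ≤ a k) : MeanSummable f s g := by
  refine ne_top_of_le_ne_top ha.tsum_ofReal_ne_top (ENNReal.tsum_le_tsum fun k => ?_)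
  calc ∫⁻ u, ENNReal.ofReal (g (urn f s u k)) ∂drawMeasure
      ≤ ∫⁻ _, ENNReal.ofReal (a k) ∂drawMeasure := by
        refine lintegral_mono fun u => ENNReal.ofReal_le_ofReal (h k _ ?_)
        rw [urn_snd]
        linarith [hs.2]
    _ = ENNReal.ofReal (a k) := by simp

lemma meanSummable_inv_mul_sqrt (hs : IsUrnState s) :
    MeanSummable f s fun q => 1 / ((q.2 + 1) * √(q.2 + 1)) := by
  refine MeanSummable.of_summable hs ((summable_nat_add_iff 1).2
    (Real.summable_one_div_nat_rpow.2 (by norm_num : (1 : ℝ) < 1 + 1 / 2))) fun k q hk => ?_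
  have hpos : (0 : ℝ) < (k + 1 : ℕ) := by positivity
  rw [Real.rpow_add hpos, Real.rpow_one, ← Real.sqrt_eq_rpow]
  have hkq : (k : ℝ) + 1 ≤ q.2 + 1 := add_le_add_left hk 1
  push_cast at hpos ⊢
  have := hpos.le.trans hkq
  gcongr

lemma tsum_ne_top_of_telescope {a d e : ℕ → ℝ≥0∞} (h : ∀ k, a (k + 1) + d k ≤ a k + e k)
    (ha : a 0 ≠ ⊤) (he : ∑' k, e k ≠ ⊤) : ∑' k, d k ≠ ⊤ := by
  have hsum : ∀ n, a n + ∑ k ∈ Finset.range n, d k ≤ a 0 + ∑ k ∈ Finset.range n, e k := by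
    intro n
    induction n with
    | zero => simp
    | succ n ih =>
      rw [Finset.sum_range_succ, Finset.sum_range_succ]
      calc a (n + 1) + (∑ k ∈ Finset.range n, d k + d n)
          = (a (n + 1) + d n) + ∑ k ∈ Finset.range n, d k := by ring
        _ ≤ (a n + e n) + ∑ k ∈ Finset.range n, d k := add_le_add_left (h n) _
        _ = (a n + ∑ k ∈ Finset.range n, d k) + e n := by ring
        _ ≤ (a 0 + ∑ k ∈ Finset.range n, e k) + e n := by gcongr
        _ = a 0 + (∑ k ∈ Finset.range n, e k + e n) := by ring
  refine ne_top_of_le_ne_top (ENNReal.add_ne_top.2 ⟨ha, he⟩)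
    (ENNReal.tsum_le_of_sum_range_le fun n => ?_)
  exact le_add_self.trans ((hsum n).trans (add_le_add_right (ENNReal.sum_le_tsum _) _))

lemma MeanSummable.of_potential (hf : Measurable f) (hf01 : ∀ t, f t ∈ Set.Icc (0 : ℝ) 1)
    (hs : IsUrnState s) {V d e : UrnState → ℝ} (hV : Measurable V)
    (hV0 : ∀ q, IsUrnState q → 0 ≤ V q) (hd0 : ∀ q, IsUrnState q → 0 ≤ d q)
    (h : ∀ q, IsUrnState q →
      f q.1 * V (addBall 1 q) + (1 - f q.1) * V (addBall 0 q) + d q ≤ V q + e q)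
    (he : MeanSummable f s e) : MeanSummable f s d := by
  refine tsum_ne_top_of_telescope
    (a := fun k => ∫⁻ u, ENNReal.ofReal (V (urn f s u k)) ∂drawMeasure) (fun k => ?_)
    (by simp [urn]) he
  have hmu := measurable_urn hf s k
  have hm := measurable_addBall
  rw [lintegral_urn_succ hf hf01 s hV.ennreal_ofReal, ← lintegral_add_left (by fun_prop),
    ← lintegral_add_left (by fun_prop)]
  refine lintegral_mono fun u => ?_
  have hq := hs.urn f u k
  generalize urn f s u k = q at hq ⊢
  have hp := hf01 q.1
  have hp' : 0 ≤ 1 - f q.1 := sub_nonneg.2 hp.2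
  have hred := mul_nonneg hp.1 (hV0 _ (hq.addBall (h := 1) (by simp)))
  have hblack := mul_nonneg hp' (hV0 _ (hq.addBall (h := 0) (by simp)))
  rw [← ENNReal.ofReal_mul hp.1, ← ENNReal.ofReal_mul hp', ← ENNReal.ofReal_add hred hblack,
    ← ENNReal.ofReal_add (add_nonneg hred hblack) (hd0 q hq)]
  exact (ENNReal.ofReal_le_ofReal (h q hq)).trans ENNReal.ofReal_add_le

end MeanSum

/-! ### Concentration at the fixed point -/

section Excess

lemma add_pow_le_of_abs_le {y t : ℝ} (ht : |t| ≤ y) (n : ℕ) :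
    (y + t) ^ (n + 2) ≤
      y ^ (n + 2) + (n + 2) * y ^ (n + 1) * t + (2 ^ (n + 2) - n - 3) * (y ^ n * t ^ 2) := by
  obtain ⟨hty, hty'⟩ := abs_le.1 ht
  have hy : 0 ≤ y := (abs_nonneg t).trans ht
  induction n with
  | zero =>
    apply le_of_eq
    push_cast
    ring
  | succ n ih =>
    have hC : (0 : ℝ) ≤ 2 ^ (n + 2) - n - 3 := by
      have : n + 3 ≤ 2 ^ (n + 2) := Nat.lt_two_pow_self
      rw [sub_sub, sub_nonneg]
      exact_mod_cast this
    have hE : (2 ^ (n + 2) - n - 3) * (y ^ n * t ^ 2) * (y + t) ≤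
        (2 ^ (n + 2) - n - 3) * (y ^ n * t ^ 2) * (2 * y) :=
      mul_le_mul_of_nonneg_left (by linarith) (by positivity)
    calc (y + t) ^ (n + 1 + 2) = (y + t) ^ (n + 2) * (y + t) := pow_succ _ _
      _ ≤ (y ^ (n + 2) + (n + 2) * y ^ (n + 1) * t + (2 ^ (n + 2) - n - 3) * (y ^ n * t ^ 2)) *
          (y + t) := mul_le_mul_of_nonneg_right ih (by linarith)
      _ ≤ _ := by
        push_cast
        linear_combination hE

lemma abs_add_pow_le {y : ℝ} (hy : 0 ≤ y) (t : ℝ) (n : ℕ) :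
    |y + t| ^ (n + 2) ≤ y ^ (n + 2) + (n + 2) * y ^ (n + 1) * t +
      (2 ^ (n + 2) + n + 2) * (y ^ n * t ^ 2 + |t| ^ (n + 2)) := by
  rcases le_or_gt |t| y with hty | hyt
  · rw [abs_of_nonneg (by linarith [neg_abs_le t])]
    refine (add_pow_le_of_abs_le hty n).trans (add_le_add_right ?_ _)
    refine mul_le_mul (by linarith [(n.cast_nonneg : (0 : ℝ) ≤ n)]) ?_ ?_ ?_ <;>
      first | positivity | exact le_add_of_nonneg_right (by positivity)
  · have hpow : |y + t| ^ (n + 2) ≤ 2 ^ (n + 2) * |t| ^ (n + 2) := by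
      rw [← mul_pow]
      refine pow_le_pow_left₀ (abs_nonneg _) ((abs_add_le y t).trans ?_) _
      rw [abs_of_nonneg hy]
      linarith
    have hlin : y ^ (n + 1) * -t ≤ |t| ^ (n + 2) :=
      calc y ^ (n + 1) * -t ≤ y ^ (n + 1) * |t| := by gcongr; exact neg_le_abs t
        _ ≤ |t| ^ (n + 1) * |t| := by gcongr
        _ = |t| ^ (n + 2) := (pow_succ _ _).symm
    have hmul := mul_le_mul_of_nonneg_left hlin (by positivity : (0 : ℝ) ≤ n + 2)
    have hnonneg : 0 ≤ y ^ (n + 2) + (2 ^ (n + 2) + n + 2) * (y ^ n * t ^ 2) := by positivity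
    linear_combination hpow + hmul + hnonneg

/-- The amount by which the distance of the proportion of Red balls from `p` exceeds `ρ`. -/
noncomputable def excess (p ρ : ℝ) (q : UrnState) : ℝ := max (|q.1 - p| - ρ) 0

/-- The direction from `p` to `a`, which is `1` when `a = p`. -/
noncomputable def direction (p a : ℝ) : ℝ := if p ≤ a then 1 else -1

variable {p ρ : ℝ} {q : UrnState}

lemma excess_nonneg : 0 ≤ excess p ρ q := le_max_right _ _

lemma excess_le_one (hp : p ∈ Set.Icc (0 : ℝ) 1) (hρ : 0 ≤ ρ) (hq : IsUrnState q) :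
    excess p ρ q ≤ 1 := by
  have := abs_sub_le_of_le_of_le hq.1.1 hq.1.2 hp.1 hp.2
  exact max_le (by linarith) zero_le_one

lemma measurable_excess (p ρ : ℝ) : Measurable (excess p ρ) := by
  unfold excess
  fun_prop

lemma abs_direction (p a : ℝ) : |direction p a| = 1 := by
  unfold direction
  split_ifs <;> simp

lemma direction_mul_sub (p a : ℝ) : direction p a * (a - p) = |a - p| := by
  unfold direction
  split_ifs with h
  · rw [one_mul, abs_of_nonneg (sub_nonneg.2 h)]
  · rw [neg_one_mul, abs_of_nonpos (sub_nonpos.2 (not_le.1 h).le)]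

lemma excess_le_abs_add (hρ : 0 ≤ ρ) (q' : UrnState) :
    excess p ρ q' ≤ |excess p ρ q + direction p q.1 * (q'.1 - q.1)| := by
  have hdist : |q'.1 - p| = |(|q.1 - p|) + direction p q.1 * (q'.1 - q.1)| := by
    rw [← direction_mul_sub p q.1, ← mul_add, abs_mul, abs_direction, one_mul]
    congr 1
    ring
  have hdiff : |(|q.1 - p| - excess p ρ q)| ≤ ρ := by
    unfold excess
    rcases max_cases (|q.1 - p| - ρ) 0 with ⟨h, -⟩ | ⟨h, h'⟩
    · rw [h, sub_sub_cancel, abs_of_nonneg hρ]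
    · rw [h, sub_zero, abs_abs]
      linarith
  refine max_le ?_ (abs_nonneg _)
  rw [hdist, sub_le_iff_le_add]
  calc |(|q.1 - p|) + direction p q.1 * (q'.1 - q.1)|
      = |(excess p ρ q + direction p q.1 * (q'.1 - q.1)) + (|q.1 - p| - excess p ρ q)| := by
        congr 1
        ring
    _ ≤ _ := (abs_add_le _ _).trans (add_le_add_right hdiff _)

lemma excess_addBall_pow_le (hρ : 0 ≤ ρ) (hq : IsUrnState q) {h : ℝ} (hh : h ∈ Set.Icc (0 : ℝ) 1)
    (n : ℕ) :
    excess p ρ (addBall h q) ^ (n + 2) ≤ excess p ρ q ^ (n + 2) +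
      (n + 2) * excess p ρ q ^ (n + 1) * (direction p q.1 * (h - q.1) / (q.2 + 1)) +
      (2 ^ (n + 2) + n + 2) *
        (excess p ρ q ^ n * (1 / (q.2 + 1)) ^ 2 + (1 / (q.2 + 1)) ^ (n + 2)) := by
  have hl : 0 < q.2 + 1 := by linarith [hq.2]
  have hstep : direction p q.1 * ((addBall h q).1 - q.1) =
      direction p q.1 * (h - q.1) / (q.2 + 1) := by
    unfold addBall
    field_simp
    ring
  have hsize : |direction p q.1 * (h - q.1) / (q.2 + 1)| ≤ 1 / (q.2 + 1) := by
    rw [abs_div, abs_mul, abs_direction, one_mul, abs_of_pos hl]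
    gcongr
    exact (abs_sub_le_of_le_of_le hh.1 hh.2 hq.1.1 hq.1.2).trans_eq (sub_zero 1)
  have hy := excess_nonneg (p := p) (ρ := ρ) (q := q)
  refine (pow_le_pow_left₀ excess_nonneg (excess_le_abs_add hρ _) _).trans
    ((abs_add_pow_le hy _ n).trans ?_)
  rw [hstep, ← sq_abs (direction p q.1 * (h - q.1) / (q.2 + 1))]
  gcongr

lemma mean_excess_addBall_pow_le (hρ : 0 ≤ ρ) (hq : IsUrnState q) {x : ℝ}
    (hx : x ∈ Set.Icc (0 : ℝ) 1) (m : ℕ) :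
    x * ((q.2 + 1) * excess p ρ (addBall 1 q) ^ (m + 3)) +
        (1 - x) * ((q.2 + 1) * excess p ρ (addBall 0 q) ^ (m + 3)) ≤
      (q.2 + 1) * excess p ρ q ^ (m + 3) +
        (m + 3) * excess p ρ q ^ (m + 2) * (direction p q.1 * (x - q.1)) +
        (2 ^ (m + 3) + m + 3) *
          (excess p ρ q ^ (m + 1) / (q.2 + 1) + 1 / ((q.2 + 1) * √(q.2 + 1))) := by
  have hL : 0 < q.2 + 1 := by linarith [hq.2]
  have hL1 : 1 ≤ q.2 + 1 := by linarith [hq.2]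
  have hred := mul_le_mul_of_nonneg_left
    (excess_addBall_pow_le (p := p) hρ hq (by simp : (1 : ℝ) ∈ Set.Icc 0 1) (m + 1))
    (mul_nonneg hx.1 hL.le)
  have hblack := mul_le_mul_of_nonneg_left
    (excess_addBall_pow_le (p := p) hρ hq (by simp : (0 : ℝ) ∈ Set.Icc 0 1) (m + 1))
    (mul_nonneg (sub_nonneg.2 hx.2) hL.le)
  have herr : (q.2 + 1) * (1 / (q.2 + 1)) ^ (m + 3) ≤ 1 / ((q.2 + 1) * √(q.2 + 1)) :=
    calc (q.2 + 1) * (1 / (q.2 + 1)) ^ (m + 3) = (1 / (q.2 + 1)) ^ (m + 2) := by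
          rw [pow_succ]
          field_simp
      _ ≤ (1 / (q.2 + 1)) ^ 2 :=
        pow_le_pow_of_le_one (by positivity) ((div_le_one hL).2 hL1) (by lia)
      _ = 1 / ((q.2 + 1) * (q.2 + 1)) := by rw [div_pow, one_pow, sq]
      _ ≤ 1 / ((q.2 + 1) * √(q.2 + 1)) := by
        gcongr
        exact Real.sqrt_le_self_iff.2 (Or.inr hL1)
  have hCerr := mul_le_mul_of_nonneg_left herr (by positivity : (0 : ℝ) ≤ 2 ^ (m + 3) + m + 3)
  push_cast at hred hblack
  linear_combination hred + hblack + hCerr +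
    ((m + 3) * excess p ρ q ^ (m + 2) * (direction p q.1 * (x - q.1)) +
      (2 ^ (m + 3) + m + 3) * excess p ρ q ^ (m + 1) / (q.2 + 1)) * mul_inv_cancel₀ hL.ne'

variable {f : ℝ → ℝ} {s : UrnState}

lemma pow_div_le_of_le_one {y K L : ℝ} (hy : y ∈ Set.Icc (0 : ℝ) 1) (hK : 0 < K) (hL : 0 < L)
    (m : ℕ) : y ^ (m + 1) / L ≤ y ^ (m + 3) / K + √K / (L * √L) := by
  obtain ⟨hy0, hy1⟩ := hy
  rcases le_or_gt K (y ^ 2 * L) with h | h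
  · have hle : y ^ (m + 1) / L ≤ y ^ (m + 3) / K := by
      rw [div_le_div_iff₀ hL hK]
      calc y ^ (m + 1) * K ≤ y ^ (m + 1) * (y ^ 2 * L) := by gcongr
        _ = y ^ (m + 3) * L := by ring
    exact hle.trans (le_add_of_nonneg_right (by positivity))
  · have hle : y ^ (m + 1) / L ≤ √K / (L * √L) := by
      rw [mul_comm, ← div_div]
      gcongr
      rw [← Real.sqrt_div hK.le]
      refine (pow_le_of_le_one hy0 hy1 m.succ_ne_zero).trans (Real.le_sqrt_of_sq_le ?_)
      exact ((lt_div_iff₀ hL).2 h).le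
    exact hle.trans (le_add_of_nonneg_left (by positivity))

lemma pow_mul_le_of_mul_le {y t c b : ℝ} (hy : y ∈ Set.Icc (0 : ℝ) 1) (hb : 0 ≤ b)
    (h : y * t ≤ -(c * y ^ 2) + b) (m : ℕ) : y ^ (m + 2) * t ≤ -(c * y ^ (m + 3)) + b := by
  obtain ⟨hy0, hy1⟩ := hy
  calc y ^ (m + 2) * t = y ^ (m + 1) * (y * t) := by ring
    _ ≤ y ^ (m + 1) * (-(c * y ^ 2) + b) := by gcongr
    _ = -(c * y ^ (m + 3)) + y ^ (m + 1) * b := by ring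
    _ ≤ -(c * y ^ (m + 3)) + b := by
      gcongr
      exact mul_le_of_le_one_left hb (pow_le_one₀ hy0 hy1)

/- The potential is `l * excess ^ (m + 3)`: as `l` grows by one at each draw, it loses in mean
`(m + 3) * c - 1` times `excess ^ (m + 3)`. -/
lemma meanSummable_excess_pow (hf : Measurable f) (hf01 : ∀ t, f t ∈ Set.Icc (0 : ℝ) 1)
    (hs : IsUrnState s) (hp : p ∈ Set.Icc (0 : ℝ) 1) (hρ : 0 ≤ ρ) {B : UrnState → ℝ}
    (hB : Measurable B) (hB0 : ∀ q, 0 ≤ B q) (hBs : MeanSummable f s B) {c : ℝ} {m : ℕ}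
    (hc : 1 < (m + 3) * c)
    (hdrift : ∀ q, IsUrnState q →
      excess p ρ q * (direction p q.1 * (f q.1 - q.1)) ≤ -(c * excess p ρ q ^ 2) + B q) :
    MeanSummable f s fun q => excess p ρ q ^ (m + 3) := by
  set κ := (m + 3) * c - 1
  have hκ : 0 < κ := sub_pos.2 hc
  set C : ℝ := 2 ^ (m + 3) + m + 3 with hC_def
  have hC : 0 < C := by positivity
  have hme := measurable_excess p ρ
  have hpot : MeanSummable f s fun q => κ / 2 * excess p ρ q ^ (m + 3) := by
    refine MeanSummable.of_potential hf hf01 hs (V := fun q => q.2 * excess p ρ q ^ (m + 3))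
      (e := fun q => (m + 3) * B q + C * (√(2 * C / κ) + 1) * (1 / ((q.2 + 1) * √(q.2 + 1))))
      (by fun_prop) (fun q hq => mul_nonneg hq.2.le (pow_nonneg excess_nonneg _))
      (fun q _ => by have := excess_nonneg (p := p) (ρ := ρ) (q := q); positivity)
      (fun q hq => ?_) ((hBs.const_mul (by positivity)).add hf (by fun_prop)
        ((meanSummable_inv_mul_sqrt hs).const_mul (by positivity)))
    have hL : 0 < q.2 + 1 := by linarith [hq.2]
    have hy := excess_nonneg (p := p) (ρ := ρ) (q := q)
    have hy1 := excess_le_one hp hρ hq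
    have hmean := mean_excess_addBall_pow_le (p := p) hρ hq (hf01 q.1) m
    have hyoung := pow_div_le_of_le_one ⟨hy, hy1⟩ (by positivity : 0 < 2 * C / κ) hL m
    have hdrift' := pow_mul_le_of_mul_le ⟨hy, hy1⟩ (hB0 q) (hdrift q hq) m
    have hC' : C * (excess p ρ q ^ (m + 3) / (2 * C / κ)) = κ / 2 * excess p ρ q ^ (m + 3) := by
      field_simp
    change f q.1 * ((q.2 + 1) * _) + (1 - f q.1) * ((q.2 + 1) * _) + _ ≤ _
    have hyoung' := mul_le_mul_of_nonneg_left hyoung hC.le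
    have hdrift'' := mul_le_mul_of_nonneg_left hdrift' (by positivity : (0 : ℝ) ≤ m + 3)
    rw [← hC_def] at hmean
    linear_combination hmean + hdrift'' + hyoung' + hC'
  refine (hpot.const_mul (by positivity : 0 ≤ 2 / κ)).mono hs fun q _ => le_of_eq ?_
  field_simp

end Excess

/-- `p` is the only fixed point of `f` in `[0, 1]`. -/
structure IsUniqueFixedPoint (f : ℝ → ℝ) (p : ℝ) : Prop where
  mem : p ∈ Set.Icc (0 : ℝ) 1
  eq_self : f p = p
  unique : ∀ q ∈ Set.Icc (0 : ℝ) 1, f q = q → q = p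

/-- The indicator function of the states whose proportion of Red balls is at distance at least `r`
from `p`. -/
noncomputable def far (p r : ℝ) (q : UrnState) : ℝ := if r ≤ |q.1 - p| then 1 else 0

lemma far_nonneg {p r : ℝ} {q : UrnState} : 0 ≤ far p r q := by
  unfold far
  split_ifs <;> norm_num

lemma measurable_far (p r : ℝ) : Measurable (far p r) := by
  refine Measurable.ite (measurableSet_le measurable_const ?_) measurable_const measurable_const
  fun_prop

section Concentration

variable {f : ℝ → ℝ} {p r : ℝ} {s : UrnState}

lemma IsUniqueFixedPoint.le_self (hp : IsUniqueFixedPoint f p) (hfc : Continuous f)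
    (hf01 : ∀ t, f t ∈ Set.Icc (0 : ℝ) 1) {a : ℝ} (ha : a ≤ 1) (hpa : p ≤ a) : f a ≤ a := by
  by_contra! h
  obtain ⟨q, hq, hq0⟩ := intermediate_value_Icc' ha
    (f := fun x => f x - x) (by fun_prop) ⟨sub_nonpos.2 (hf01 1).2, (sub_pos.2 h).le⟩
  have hqp := hp.unique q ⟨hp.mem.1.trans (hpa.trans hq.1), hq.2⟩ (sub_eq_zero.1 hq0)
  have hap : a = p := le_antisymm (hq.1.trans_eq hqp) hpa
  exact h.ne' (hap ▸ hp.eq_self)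

lemma IsUniqueFixedPoint.self_le (hp : IsUniqueFixedPoint f p) (hfc : Continuous f)
    (hf01 : ∀ t, f t ∈ Set.Icc (0 : ℝ) 1) {a : ℝ} (ha : 0 ≤ a) (hpa : a ≤ p) : a ≤ f a := by
  by_contra! h
  obtain ⟨q, hq, hq0⟩ := intermediate_value_Icc' ha
    (f := fun x => f x - x) (by fun_prop) ⟨(sub_neg.2 h).le, sub_nonneg.2 (hf01 0).1⟩
  have hqp := hp.unique q ⟨hq.1, hq.2.trans (hpa.trans hp.mem.2)⟩ (sub_eq_zero.1 hq0)
  have hap : a = p := le_antisymm hpa (hqp.symm.trans_le hq.2)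
  exact h.ne (hap ▸ hp.eq_self)

lemma IsUniqueFixedPoint.direction_mul_sub_self (hp : IsUniqueFixedPoint f p) (hfc : Continuous f)
    (hf01 : ∀ t, f t ∈ Set.Icc (0 : ℝ) 1) {a : ℝ} (ha : a ∈ Set.Icc (0 : ℝ) 1) :
    direction p a * (f a - a) = -|f a - a| := by
  unfold direction
  split_ifs with hpa
  · rw [one_mul, abs_of_nonpos (sub_nonpos.2 (hp.le_self hfc hf01 ha.2 hpa)), neg_neg]
  · rw [neg_one_mul, abs_of_nonneg (sub_nonneg.2 (hp.self_le hfc hf01 ha.1 (not_le.1 hpa).le))]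

lemma IsUniqueFixedPoint.exists_pos_le_abs_sub (hp : IsUniqueFixedPoint f p) (hfc : Continuous f)
    (hr : 0 < r) : ∃ κ, 0 < κ ∧ ∀ a ∈ Set.Icc (0 : ℝ) 1, r ≤ |a - p| → κ ≤ |f a - a| := by
  have hcompact : IsCompact (Set.Icc (0 : ℝ) 1 ∩ {a | r ≤ |a - p|}) :=
    isCompact_Icc.inter_right (isClosed_le continuous_const (by fun_prop))
  obtain ⟨κ, hκ, hle⟩ := hcompact.exists_forall_le'
    (f := fun a => |f a - a|) (a := 0) (by fun_prop) fun a ⟨ha, har⟩ => abs_pos.2 fun h0 => by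
      have hle : r ≤ |a - p| := har
      rw [hp.unique a ha (sub_eq_zero.1 h0), sub_self, abs_zero] at hle
      exact hle.not_gt hr
  exact ⟨κ, hκ, fun a ha har => hle a ⟨ha, har⟩⟩

lemma meanSummable_far (hfc : Continuous f) (hf01 : ∀ t, f t ∈ Set.Icc (0 : ℝ) 1)
    (hp : IsUniqueFixedPoint f p) (hs : IsUrnState s) (hr : 0 < r) :
    MeanSummable f s (far p r) := by
  obtain ⟨κ, hκ, hle⟩ := hp.exists_pos_le_abs_sub hfc (half_pos hr)
  obtain ⟨m, hm⟩ := exists_nat_gt (1 / κ)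
  have hexcess : MeanSummable f s fun q => excess p (r / 2) q ^ (m + 3) := by
    refine meanSummable_excess_pow hfc.measurable hf01 hs hp.mem (by positivity)
      (B := fun _ => 0) measurable_const (fun _ => le_rfl) (by simp [MeanSummable, meanSum])
      (c := κ) ?_ fun q hq => ?_
    · linarith [(div_lt_iff₀ hκ).1 hm]
    · rw [hp.direction_mul_sub_self hfc hf01 hq.1, add_zero, mul_neg, neg_le_neg_iff]
      have hy := excess_nonneg (p := p) (ρ := r / 2) (q := q)
      have hy1 := excess_le_one hp.mem (half_pos hr).le hq
      rcases le_total (r / 2) |q.1 - p| with h | h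
      · calc κ * excess p (r / 2) q ^ 2 ≤ κ * excess p (r / 2) q := by
              gcongr
              exact pow_le_of_le_one hy hy1 two_ne_zero
          _ ≤ |f q.1 - q.1| * excess p (r / 2) q := by
              gcongr
              exact hle q.1 hq.1 h
          _ = _ := mul_comm _ _
      · simp [excess, h]
  refine (hexcess.const_mul (by positivity : 0 ≤ (2 / r) ^ (m + 3))).mono hs fun q _ => ?_
  rw [far, ← mul_pow]
  split_ifs with h
  · refine one_le_pow₀ ?_
    calc (1 : ℝ) = 2 / r * (r / 2) := by field_simp
      _ ≤ 2 / r * excess p (r / 2) q := by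
        gcongr
        exact le_max_of_le_left (by linarith)
  · exact pow_nonneg (mul_nonneg (by positivity) excess_nonneg) _

lemma MeanSummable.of_eventually_le (hfc : Continuous f) (hf01 : ∀ t, f t ∈ Set.Icc (0 : ℝ) 1)
    (hp : IsUniqueFixedPoint f p) (hs : IsUrnState s) {g h : ℝ → ℝ} {M : ℝ}
    (hg : MeanSummable f s fun q => g q.1) (hM : ∀ a, h a ≤ M + g a)
    (hle : ∀ᶠ a in 𝓝 p, h a ≤ g a) : MeanSummable f s fun q => h q.1 := by
  obtain ⟨r, hr, hball⟩ := Metric.eventually_nhds_iff.1 hle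
  have hmf := measurable_far p r
  refine (((meanSummable_far hfc hf01 hp hs hr).const_mul (abs_nonneg M)).add hfc.measurable
    (by fun_prop) hg).mono hs fun q _ => ?_
  unfold far
  split_ifs with hq
  · linarith [hM q.1, le_abs_self M]
  · linarith [hball (Real.dist_eq q.1 p ▸ not_le.1 hq)]

lemma meanSummable_neg_and_meanSum_eq_top (hfc : Continuous f)
    (hf01 : ∀ t, f t ∈ Set.Icc (0 : ℝ) 1) (hp : IsUniqueFixedPoint f p) (hs : IsUrnState s)
    {h : ℝ → ℝ} {M : ℝ} (hM : ∀ a, -M ≤ h a) (hc : ContinuousAt h p) (hpos : 0 < h p) :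
    (MeanSummable f s fun q => -h q.1) ∧ meanSum f s (fun q => h q.1) = ⊤ := by
  have hhalf : ∀ᶠ a in 𝓝 p, h p / 2 ≤ h a :=
    (hc.eventually (lt_mem_nhds (half_lt_self hpos))).mono fun _ => le_of_lt
  have hzero : MeanSummable f s fun _ => 0 := by simp [MeanSummable, meanSum]
  refine ⟨hzero.of_eventually_le (g := fun _ => 0) (h := fun a => -h a) (M := M) hfc hf01 hp hs
    (fun a => by linarith [hM a]) (hhalf.mono fun a ha => by linarith), ?_⟩
  by_contra hne
  have hconst : MeanSummable f s fun _ => h p / 2 :=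
    MeanSummable.of_eventually_le (g := h) (h := fun _ => h p / 2) (M := M + h p / 2)
      hfc hf01 hp hs hne (fun a => by linarith [hM a]) hhalf
  exact hconst (by simp [meanSum, hpos])

lemma meanSummable_abs_sub_pow_three (hfc : Continuous f) (hf01 : ∀ t, f t ∈ Set.Icc (0 : ℝ) 1)
    (hp : IsUniqueFixedPoint f p) (hs : IsUrnState s)
    (hflat : ∀ᶠ a in 𝓝 p, |f a - p| ≤ |a - p| / 2) :
    MeanSummable f s fun q => |q.1 - p| ^ 3 := by
  obtain ⟨r, hr, hball⟩ := Metric.eventually_nhds_iff.1 hflat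
  have hexcess : ∀ q, excess p 0 q = |q.1 - p| := fun q => by simp [excess]
  have hmf := measurable_far p r
  have := meanSummable_excess_pow hfc.measurable hf01 hs hp.mem le_rfl (m := 0)
    (B := fun q => 1 / 2 * far p r q) (c := 1 / 2) (by fun_prop)
    (fun q => mul_nonneg (by norm_num) far_nonneg)
    ((meanSummable_far hfc hf01 hp hs hr).const_mul (by norm_num)) (by norm_num) fun q hq => ?_
  · simpa only [hexcess] using this
  rw [hexcess]
  have hy := abs_nonneg (q.1 - p)
  by_cases hfar : r ≤ |q.1 - p|
  · have hy1 := abs_sub_le_of_le_of_le hq.1.1 hq.1.2 hp.mem.1 hp.mem.2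
    rw [far, if_pos hfar, hp.direction_mul_sub_self hfc hf01 hq.1]
    linarith [mul_nonneg hy (abs_nonneg (f q.1 - q.1)), pow_le_one₀ (n := 2) hy (by linarith)]
  · have hfp : direction p q.1 * (f q.1 - p) ≤ |q.1 - p| / 2 :=
      calc direction p q.1 * (f q.1 - p) ≤ |direction p q.1 * (f q.1 - p)| := le_abs_self _
        _ = |f q.1 - p| := by rw [abs_mul, abs_direction, one_mul]
        _ ≤ |q.1 - p| / 2 := hball (Real.dist_eq q.1 p ▸ not_le.1 hfar)
    rw [far, if_neg hfar]
    linear_combination mul_le_mul_of_nonneg_left hfp hy - |q.1 - p| * direction_mul_sub p q.1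

lemma meanSummable_of_isBigO (hfc : Continuous f) (hf01 : ∀ t, f t ∈ Set.Icc (0 : ℝ) 1)
    (hp : IsUniqueFixedPoint f p) (hs : IsUrnState s)
    (hflat : (fun a => f a - p) =o[𝓝 p] fun a => a - p) {h : ℝ → ℝ} {M : ℝ} (hM : ∀ a, h a ≤ M)
    (hO : h =O[𝓝 p] fun a => (a - p) ^ 3) : MeanSummable f s fun q => h q.1 := by
  obtain ⟨C, hC, hCO⟩ := hO.exists_nonneg
  have hcube := meanSummable_abs_sub_pow_three hfc hf01 hp hs
    ((hflat.def one_half_pos).mono fun a ha => by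
      simpa only [Real.norm_eq_abs, one_div_mul_eq_div] using ha)
  refine (hcube.const_mul hC).of_eventually_le (g := fun a => C * |a - p| ^ 3) (M := M) hfc hf01
    hp hs (fun a => ?_) (hCO.bound.mono fun a ha => ?_)
  · linarith [hM a, mul_nonneg hC (pow_nonneg (abs_nonneg (a - p)) 3)]
  · rw [norm_pow, Real.norm_eq_abs, Real.norm_eq_abs] at ha
    exact (le_abs_self _).trans ha

end Concentration

/-! ### Local behaviour at a critical point -/

section CriticalPoint

variable {f : ℝ → ℝ} {c : ℝ}

lemma isBigO_sub_pow_succ_of_deriv {n : ℕ} (hf : ∀ᶠ a in 𝓝 c, DifferentiableAt ℝ f a)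
    (hf' : deriv f =O[𝓝 c] fun a => (a - c) ^ n) :
    (fun a => f a - f c) =O[𝓝 c] fun a => (a - c) ^ (n + 1) := by
  obtain ⟨C, hC, hbound⟩ := hf'.exists_nonneg
  obtain ⟨r, hr, hball⟩ := Metric.eventually_nhds_iff_ball.1 (hf.and hbound.bound)
  refine Asymptotics.IsBigO.of_bound C ?_
  filter_upwards [Metric.ball_mem_nhds c hr] with a ha
  have hsub : Metric.closedBall c |a - c| ⊆ Metric.ball c r := fun x hx =>
    (Metric.mem_closedBall.1 hx).trans_lt ha
  rw [pow_succ, norm_mul, ← mul_assoc]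
  refine (convex_closedBall c |a - c|).norm_image_sub_le_of_norm_deriv_le
    (fun x hx => (hball x (hsub hx)).1) (fun x hx => ?_)
    (Metric.mem_closedBall_self (abs_nonneg _)) (Real.dist_eq a c).le
  refine (hball x (hsub hx)).2.trans (mul_le_mul_of_nonneg_left ?_ hC)
  rw [norm_pow, norm_pow]
  exact pow_le_pow_left₀ (norm_nonneg _) (Metric.mem_closedBall.1 hx) n

lemma isBigO_sub_pow_three_of_deriv_eq_zero (hf : ContDiffAt ℝ 3 f c) (hd : deriv f c = 0)
    (hdd : deriv (deriv f) c = 0) : (fun a => f a - f c) =O[𝓝 c] fun a => (a - c) ^ 3 := by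
  have hf' : ContDiffAt ℝ 2 (deriv f) c := hf.derivWithin (by norm_num)
  have hf'' : ContDiffAt ℝ 1 (deriv (deriv f)) c := hf'.derivWithin (by norm_num)
  have hdiff : ∀ᶠ a in 𝓝 c, DifferentiableAt ℝ f a :=
    (hf.eventually (by decide)).mono fun _ ha => ha.differentiableAt three_ne_zero
  have hdiff' : ∀ᶠ a in 𝓝 c, DifferentiableAt ℝ (deriv f) a :=
    (hf'.eventually (by decide)).mono fun _ ha => ha.differentiableAt two_ne_zero
  have hO : deriv (deriv f) =O[𝓝 c] fun a => (a - c) ^ 1 := by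
    simpa only [hdd, sub_zero, pow_one] using
      (hf''.differentiableAt one_ne_zero).isBigO_sub
  have hO' : deriv f =O[𝓝 c] fun a => (a - c) ^ 2 := by
    simpa only [hd, sub_zero] using isBigO_sub_pow_succ_of_deriv hdiff' hO
  exact isBigO_sub_pow_succ_of_deriv hdiff hO'

lemma isLocalMin_or_isLocalMax_or_isBigO (hf : ContDiffAt ℝ 3 f c) (hd : deriv f c = 0) :
    IsLocalMin f c ∨ IsLocalMax f c ∨ (fun a => f a - f c) =O[𝓝 c] fun a => (a - c) ^ 3 := by
  rcases lt_trichotomy (deriv (deriv f) c) 0 with hneg | hzero | hpos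
  · exact Or.inr (Or.inl (isLocalMax_of_deriv_deriv_neg hneg hd hf.continuousAt))
  · exact Or.inr (Or.inr (isBigO_sub_pow_three_of_deriv_eq_zero hf hd hzero))
  · exact Or.inl (isLocalMin_of_deriv_deriv_pos hpos hd hf.continuousAt)

end CriticalPoint

/-! ### The total drift -/

/-- The increment of the drift in a given state of the urn. -/
noncomputable def driftIncrement (f : ℝ → ℝ) (q : UrnState) : ℝ := 2 * f q.1 - 1

lemma measurable_driftIncrement {f : ℝ → ℝ} (hf : Measurable f) :
    Measurable (driftIncrement f) := by
  unfold driftIncrement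
  fun_prop

section Summability

variable {f : ℝ → ℝ} {p : ℝ} {s : UrnState}

lemma meanSummable_neg_driftIncrement_and_meanSum_eq_top (hfc : Continuous f)
    (hf01 : ∀ t, f t ∈ Set.Icc (0 : ℝ) 1) (hp : IsUniqueFixedPoint f p) (hs : IsUrnState s)
    (hlt : 1 / 2 < p) :
    MeanSummable f s (fun q => -driftIncrement f q) ∧ meanSum f s (driftIncrement f) = ⊤ :=
  meanSummable_neg_and_meanSum_eq_top (h := fun a => 2 * f a - 1) (M := 1) hfc hf01 hp hs
    (fun a => by linarith [(hf01 a).1]) (by fun_prop) (by linarith [hp.eq_self])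

lemma meanSummable_driftIncrement_and_meanSum_neg_eq_top (hfc : Continuous f)
    (hf01 : ∀ t, f t ∈ Set.Icc (0 : ℝ) 1) (hp : IsUniqueFixedPoint f p) (hs : IsUrnState s)
    (hlt : p < 1 / 2) :
    MeanSummable f s (driftIncrement f) ∧ meanSum f s (fun q => -driftIncrement f q) = ⊤ := by
  have h := meanSummable_neg_and_meanSum_eq_top (h := fun a => -(2 * f a - 1)) (M := 1) hfc hf01 hp
    hs (fun a => by linarith [(hf01 a).2]) (by fun_prop) (by linarith [hp.eq_self])
  simp only [neg_neg] at h
  exact h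

lemma meanSummable_driftIncrement_or_neg (hfc : Continuous f)
    (hf01 : ∀ t, f t ∈ Set.Icc (0 : ℝ) 1) (hp : IsUniqueFixedPoint f (1 / 2)) (hs : IsUrnState s)
    (hf : ContDiffAt ℝ 3 f (1 / 2)) (hd : deriv f (1 / 2) = 0) :
    MeanSummable f s (driftIncrement f) ∨ MeanSummable f s fun q => -driftIncrement f q := by
  have hzero : MeanSummable f s fun _ => 0 := by simp [MeanSummable, meanSum]
  have hle : ∀ a, 2 * f a - 1 ≤ 1 := fun a => by linarith [(hf01 a).2]
  rcases isLocalMin_or_isLocalMax_or_isBigO hf hd with hmin | hmax | hO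
  · refine Or.inr (hzero.of_eventually_le (g := fun _ => 0) (h := fun a => -(2 * f a - 1)) (M := 1)
      hfc hf01 hp hs (fun a => by linarith [(hf01 a).1]) (hmin.mono fun a ha => ?_))
    linarith [hp.eq_self]
  · refine Or.inl (hzero.of_eventually_le (g := fun _ => 0) (h := fun a => 2 * f a - 1) (M := 1)
      hfc hf01 hp hs (fun a => by linarith [hle a]) (hmax.mono fun a ha => ?_))
    linarith [hp.eq_self]
  · have hflat : (fun a => f a - 1 / 2) =o[𝓝 (1 / 2)] fun a => a - 1 / 2 := by
      simpa only [hd, hp.eq_self, smul_zero, sub_zero] using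
        (hf.differentiableAt three_ne_zero).hasDerivAt.isLittleO
    refine Or.inl (meanSummable_of_isBigO (h := fun a => 2 * f a - 1) hfc hf01 hp hs hflat hle
      ((hO.const_mul_left 2).congr_left fun a => ?_))
    rw [hp.eq_self]
    ring

end Summability

section ExtendedReal

lemma coe_sum_ofReal {ι : Type*} (s : Finset ι) (g : ι → ℝ) :
    ((∑ k ∈ s, ENNReal.ofReal (g k) : ℝ≥0∞) : EReal) = ((∑ k ∈ s, max (g k) 0 : ℝ) : EReal) := by
  have hnonneg : ∀ k ∈ s, 0 ≤ max (g k) 0 := fun k _ => le_max_right _ _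
  rw [← max_eq_left (Finset.sum_nonneg hnonneg), ← EReal.coe_ennreal_ofReal,
    ENNReal.ofReal_sum_of_nonneg hnonneg]
  simp only [ENNReal.ofReal_max, ENNReal.ofReal_zero, zero_le, sup_of_le_left]

lemma coe_sum_eq_sub {ι : Type*} (s : Finset ι) (g : ι → ℝ) :
    ((∑ k ∈ s, g k : ℝ) : EReal) = ((∑ k ∈ s, ENNReal.ofReal (g k) : ℝ≥0∞) : EReal) -
      ((∑ k ∈ s, ENNReal.ofReal (-g k) : ℝ≥0∞) : EReal) := by
  rw [coe_sum_ofReal, coe_sum_ofReal, ← EReal.coe_sub, ← Finset.sum_sub_distrib]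
  simp only [max_zero_sub_max_neg_zero_eq_self]

lemma tendsto_coe_sum_range (g : ℕ → ℝ)
    (h : ∑' k, ENNReal.ofReal (g k) ≠ ⊤ ∨ ∑' k, ENNReal.ofReal (-g k) ≠ ⊤) :
    Tendsto (fun n => ((∑ k ∈ Finset.range n, g k : ℝ) : EReal)) atTop
      (𝓝 ((∑' k, ENNReal.ofReal (g k) : ℝ≥0∞) - (∑' k, ENNReal.ofReal (-g k) : ℝ≥0∞))) := by
  simp only [coe_sum_eq_sub, sub_eq_add_neg]
  have hsum (a : ℕ → ℝ≥0∞) : Tendsto (fun n => ((∑ k ∈ Finset.range n, a k : ℝ≥0∞) : EReal)) atTop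
      (𝓝 (∑' k, a k : ℝ≥0∞)) := EReal.tendsto_coe_ennreal.2 (ENNReal.tendsto_nat_tsum a)
  refine (EReal.continuousAt_add ?_ ?_).tendsto.comp ((hsum _).prodMk_nhds (hsum _).neg)
  · simpa only [ne_eq, EReal.coe_ennreal_eq_top_iff, EReal.neg_eq_bot_iff] using h
  · exact Or.inl (EReal.coe_ennreal_ne_bot _)

lemma neg_coe_sub {a b : ℝ≥0∞} (h : a ≠ ⊤ ∨ b ≠ ⊤) : -((a : EReal) - b) = b - a := by
  rw [EReal.neg_sub (Or.inl (EReal.coe_ennreal_ne_bot a))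
    (h.imp (by simp) (by simp)), add_comm, sub_eq_add_neg]

lemma toENNReal_coe_sub (a b : ℝ≥0∞) : ((a : EReal) - b).toENNReal = a - b := by
  rw [EReal.toENNReal_sub (EReal.coe_ennreal_nonneg b), EReal.toENNReal_coe, EReal.toENNReal_coe]

lemma coe_sub_eq_coe_sub {a b c d : ℝ≥0∞} (h : a + d = b + c) (hb : b ≠ ⊤) (hd : d ≠ ⊤) :
    (a : EReal) - b = c - d := by
  lift b to NNReal using hb
  lift d to NNReal using hd
  by_cases hc : c = ⊤
  · have ha : a = ⊤ := by simpa [hc] using h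
    rw [ha, hc]
    rfl
  · have ha : a ≠ ⊤ := fun ha => hc (by simpa [ha, eq_comm] using h)
    lift a to NNReal using ha
    lift c to NNReal using hc
    have h' : (a : ℝ) + d = b + c := by exact_mod_cast h
    simp only [EReal.coe_nnreal_eq_coe_real, ← EReal.coe_sub]
    exact congrArg Real.toEReal (by linarith)

end ExtendedReal

section Expectation

variable {Ω : Type*} [MeasurableSpace Ω] {μ : Measure Ω} {Y Z : Ω → EReal} {P N : Ω → ℝ≥0∞}

lemma HasExpectation.congr (hZ : HasExpectation μ Z) (h : Y =ᵐ[μ] Z) : HasExpectation μ Y :=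
  hZ.imp (lintegral_congr_ae (h.fun_comp EReal.toENNReal)).trans_lt
    (lintegral_congr_ae (h.fun_comp fun y => (-y).toENNReal)).trans_lt

lemma expectation_congr (h : Y =ᵐ[μ] Z) : expectation μ Y = expectation μ Z :=
  congrArg₂ (fun a b : ℝ≥0∞ => (a : EReal) - b) (lintegral_congr_ae (h.fun_comp EReal.toENNReal))
    (lintegral_congr_ae (h.fun_comp fun y => (-y).toENNReal))

lemma lintegral_toENNReal_sub_le : ∫⁻ ω, ((P ω : EReal) - N ω).toENNReal ∂μ ≤ ∫⁻ ω, P ω ∂μ :=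
  lintegral_mono fun _ => (toENNReal_coe_sub _ _).trans_le tsub_le_self

lemma lintegral_toENNReal_neg_sub_le :
    ∫⁻ ω, (-((P ω : EReal) - N ω)).toENNReal ∂μ ≤ ∫⁻ ω, N ω ∂μ := by
  refine lintegral_mono fun ω => ?_
  have hle : -((P ω : EReal) - N ω) ≤ N ω := EReal.neg_le.1 <| by
    simpa only [zero_add, sub_eq_add_neg] using
      add_le_add_left (EReal.coe_ennreal_nonneg (P ω)) (-(N ω : EReal))
  exact (EReal.toENNReal_le_toENNReal hle).trans_eq EReal.toENNReal_coe

lemma hasExpectation_sub (h : ∫⁻ ω, P ω ∂μ ≠ ⊤ ∨ ∫⁻ ω, N ω ∂μ ≠ ⊤) :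
    HasExpectation μ fun ω => (P ω : EReal) - N ω :=
  h.imp (fun h => lintegral_toENNReal_sub_le.trans_lt h.lt_top)
    fun h => lintegral_toENNReal_neg_sub_le.trans_lt h.lt_top

lemma ae_ne_top_or_ne_top (hP : Measurable P) (hN : Measurable N)
    (h : ∫⁻ ω, P ω ∂μ ≠ ⊤ ∨ ∫⁻ ω, N ω ∂μ ≠ ⊤) : ∀ᵐ ω ∂μ, P ω ≠ ⊤ ∨ N ω ≠ ⊤ := by
  rcases h with h | h
  · exact (ae_lt_top hP h).mono fun ω hω => Or.inl hω.ne
  · exact (ae_lt_top hN h).mono fun ω hω => Or.inr hω.ne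

lemma expectation_sub (hP : Measurable P) (hN : Measurable N)
    (h : ∫⁻ ω, P ω ∂μ ≠ ⊤ ∨ ∫⁻ ω, N ω ∂μ ≠ ⊤) :
    expectation μ (fun ω => (P ω : EReal) - N ω) =
      (∫⁻ ω, P ω ∂μ : ℝ≥0∞) - (∫⁻ ω, N ω ∂μ : ℝ≥0∞) := by
  have hae := ae_ne_top_or_ne_top hP hN h
  have hbalance : ∫⁻ ω, ((P ω : EReal) - N ω).toENNReal ∂μ + ∫⁻ ω, N ω ∂μ =
      ∫⁻ ω, (-((P ω : EReal) - N ω)).toENNReal ∂μ + ∫⁻ ω, P ω ∂μ := by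
    rw [← lintegral_add_right _ hN, ← lintegral_add_right _ hP]
    refine lintegral_congr_ae (hae.mono fun ω hω => ?_)
    simp only [neg_coe_sub hω, toENNReal_coe_sub, tsub_add_eq_max, max_comm]
  rcases h with h | h
  · have ha := ne_top_of_le_ne_top h (lintegral_toENNReal_sub_le (N := N))
    rw [expectation, ← neg_coe_sub (Or.inr ha), ← neg_coe_sub (Or.inr h),
      coe_sub_eq_coe_sub hbalance.symm ha h]
  · exact coe_sub_eq_coe_sub hbalance
      (ne_top_of_le_ne_top h lintegral_toENNReal_neg_sub_le) h

end Expectation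

section Drift

variable {f : ℝ → ℝ} {w : ℤ → UrnState} {x : ℤ}

instance : IsProbabilityMeasure sampleMeasure := by
  unfold sampleMeasure
  infer_instance

lemma map_sampleMeasure (x : ℤ) : sampleMeasure.map (fun ω => ω x) = drawMeasure :=
  Measure.infinitePi_map_eval
    (fun _ : ℤ => Measure.infinitePi fun _ : ℕ => (volume : Measure unitInterval)) x

lemma measurable_alpha (hf : Measurable f) (k : ℕ) :
    Measurable fun ω : Sample => alpha f w ω x k :=
  ((measurable_urn hf (w x) k).comp (measurable_pi_apply x)).fst

lemma measurable_driftPos (hf : Measurable f) : Measurable (driftPos f w x) :=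
  Measurable.tsum fun k => by
    have := measurable_alpha (w := w) (x := x) hf k
    fun_prop

lemma measurable_driftNeg (hf : Measurable f) : Measurable (driftNeg f w x) :=
  Measurable.tsum fun k => by
    have := measurable_alpha (w := w) (x := x) hf k
    fun_prop

lemma lintegral_tsum_ofReal_urn (hf : Measurable f) {g : UrnState → ℝ} (hg : Measurable g) :
    ∫⁻ ω, ∑' k, ENNReal.ofReal (g (urn f (w x) (ω x) k)) ∂sampleMeasure = meanSum f (w x) g := by
  have hm (k : ℕ) : Measurable fun u => ENNReal.ofReal (g (urn f (w x) u k)) :=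
    (hg.comp (measurable_urn hf (w x) k)).ennreal_ofReal
  refine (lintegral_tsum fun k => ((hm k).comp (measurable_pi_apply x)).aemeasurable).trans
    (tsum_congr fun k => (lintegral_map (hm k) (measurable_pi_apply x)).symm.trans ?_)
  rw [map_sampleMeasure]

lemma lintegral_driftPos (hf : Measurable f) :
    ∫⁻ ω, driftPos f w x ω ∂sampleMeasure = meanSum f (w x) (driftIncrement f) :=
  lintegral_tsum_ofReal_urn hf (measurable_driftIncrement hf)

lemma lintegral_driftNeg (hf : Measurable f) :
    ∫⁻ ω, driftNeg f w x ω ∂sampleMeasure = meanSum f (w x) fun q => -driftIncrement f q :=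
  lintegral_tsum_ofReal_urn hf (measurable_driftIncrement hf).neg

lemma lintegral_drift_ne_top_or (hf : Measurable f)
    (h : MeanSummable f (w x) (driftIncrement f) ∨
      MeanSummable f (w x) fun q => -driftIncrement f q) :
    ∫⁻ ω, driftPos f w x ω ∂sampleMeasure ≠ ⊤ ∨ ∫⁻ ω, driftNeg f w x ω ∂sampleMeasure ≠ ⊤ := by
  rwa [lintegral_driftPos hf, lintegral_driftNeg hf]

lemma ae_tendsto_drift (hf : Measurable f)
    (h : MeanSummable f (w x) (driftIncrement f) ∨
      MeanSummable f (w x) fun q => -driftIncrement f q) :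
    ∀ᵐ ω ∂sampleMeasure, Tendsto (fun n => (drift f w x n ω : EReal)) atTop
      (𝓝 ((driftPos f w x ω : EReal) - driftNeg f w x ω)) :=
  (ae_ne_top_or_ne_top (measurable_driftPos hf) (measurable_driftNeg hf)
    (lintegral_drift_ne_top_or hf h)).mono fun ω hω =>
      (tendsto_coe_sum_range (fun k => 2 * f (alpha f w ω x k) - 1) hω).comp
        (tendsto_add_atTop_nat 1)

lemma driftLimit_ae_eq (hf : Measurable f)
    (h : MeanSummable f (w x) (driftIncrement f) ∨
      MeanSummable f (w x) fun q => -driftIncrement f q) :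
    driftLimit f w x =ᵐ[sampleMeasure] fun ω => (driftPos f w x ω : EReal) - driftNeg f w x ω :=
  (ae_tendsto_drift hf h).mono fun _ hω => hω.liminf_eq

lemma driftWellDefined_of_meanSummable (hf : Measurable f)
    (h : MeanSummable f (w x) (driftIncrement f) ∨
      MeanSummable f (w x) fun q => -driftIncrement f q) :
    DriftWellDefined f w x := by
  have hfin := lintegral_drift_ne_top_or hf h
  refine ⟨?_, hfin.imp Ne.lt_top Ne.lt_top, (hasExpectation_sub hfin).congr (driftLimit_ae_eq hf h)⟩
  filter_upwards [ae_tendsto_drift hf h, driftLimit_ae_eq hf h] with ω hω heq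
  rwa [heq]

lemma expectation_driftLimit (hf : Measurable f)
    (h : MeanSummable f (w x) (driftIncrement f) ∨
      MeanSummable f (w x) fun q => -driftIncrement f q) :
    expectation sampleMeasure (driftLimit f w x) =
      meanSum f (w x) (driftIncrement f) - meanSum f (w x) fun q => -driftIncrement f q := by
  rw [expectation_congr (driftLimit_ae_eq hf h),
    expectation_sub (measurable_driftPos hf) (measurable_driftNeg hf)
      (lintegral_drift_ne_top_or hf h), lintegral_driftPos hf, lintegral_driftNeg hf]

lemma one_add_lt_of_one_lt_expectation (hf : Measurable f)
    (h : MeanSummable f (w x) (driftIncrement f) ∨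
      MeanSummable f (w x) fun q => -driftIncrement f q)
    (hE : 1 < expectation sampleMeasure (driftLimit f w x)) :
    1 + meanSum f (w x) (fun q => -driftIncrement f q) < meanSum f (w x) (driftIncrement f) := by
  rw [expectation_driftLimit hf h] at hE
  exact_mod_cast EReal.add_lt_of_lt_sub hE

lemma one_add_lt_of_expectation_lt_neg_one (hf : Measurable f)
    (h : MeanSummable f (w x) (driftIncrement f) ∨
      MeanSummable f (w x) fun q => -driftIncrement f q)
    (hE : expectation sampleMeasure (driftLimit f w x) < -1) :
    1 + meanSum f (w x) (driftIncrement f) < meanSum f (w x) fun q => -driftIncrement f q := by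
  rw [expectation_driftLimit hf h, EReal.lt_neg_comm, neg_coe_sub h] at hE
  exact_mod_cast EReal.add_lt_of_lt_sub hE

end Drift

/-! ### Transience -/

section Transience

variable {f : ℝ → ℝ} {w : ℤ → UrnState} {ε : ℝ}

lemma isDrivenWalk_walk (f : ℝ → ℝ) (w : ℤ → UrnState) (ω : Sample) :
    IsDrivenWalk (fun x => draws f (w x) (ω x)) (walk f w ω) fun n => (walkState f w ω n).2 where
  pos_zero := rfl
  loc_zero _ := rfl
  pos_succ n := by
    simp only [draws, decide_eq_true_eq]
    rfl
  loc_succ _ := rfl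

lemma iIndepFun_sites {σ : ℕ → ℤ} (hσ : Function.Injective σ) :
    iIndepFun (fun (i : ℕ) (ω : Sample) => ω (σ i)) sampleMeasure :=
  (iIndepFun_infinitePi (X := fun (_ : ℤ) u => u) fun _ => measurable_id).precomp hσ

lemma measure_recurrence_eq_zero_of_isDrivenWalk {r : (ℕ → unitInterval) → ℕ → Bool}
    {φ : ℕ → (ℕ → unitInterval) → ℝ} (h : IsCompensated drawMeasure r φ ε)
    (hd : 1 + ∑' k, ∫⁻ u, ENNReal.ofReal (-(2 * φ k u - 1)) ∂drawMeasure <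
      ∑' k, ∫⁻ u, ENNReal.ofReal (2 * φ k u - 1) ∂drawMeasure)
    {σ : ℕ → ℤ} (hσ : Function.Injective σ) {b : Sample → ℤ → ℕ → Bool} {pos : Sample → ℕ → ℤ}
    {loc : Sample → ℕ → ℤ → ℕ} (hwalk : ∀ ω, IsDrivenWalk (b ω) (pos ω) (loc ω))
    (hb : ∀ ω (i : ℕ), b ω (i + 1) = r (ω (σ i)))
    (hrec : ∀ ω ∈ recurrence f w, ∀ x, ∃ᶠ n in atTop, pos ω n = x) :
    sampleMeasure (recurrence f w) = 0 := by
  rw [measure_eq_zero_iff_ae_notMem]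
  filter_upwards [h.ae_exists_forall_backward_eq_zero hd (fun i => measurable_pi_apply (σ i))
    (iIndepFun_sites hσ) fun i => map_sampleMeasure (σ i)] with ω ⟨hinf, i, hi⟩ hω
  obtain ⟨n, hn⟩ := (hwalk ω).exists_backward_ne_zero (fun i => hb ω i ▸ hinf i) (hrec ω hω) i
  simp only [hb] at hn
  exact hn (hi n)

theorem measure_recurrence_eq_zero_of_right (hf : Measurable f) (hε : 0 < ε) (hfε : ∀ t, ε ≤ f t)
    (hf1 : ∀ t, f t ≤ 1) (hright : ∀ x : ℤ, 1 ≤ x → w x = w 1)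
    (hd : 1 + meanSum f (w 1) (fun q => -driftIncrement f q) <
      meanSum f (w 1) (driftIncrement f)) :
    sampleMeasure (recurrence f w) = 0 :=
  measure_recurrence_eq_zero_of_isDrivenWalk (isCompensated_draws hf hε hfε hf1 (w 1)) hd
    (σ := fun i => i + 1) (fun i j hij => by simpa using hij) (isDrivenWalk_walk f w)
    (fun ω i => by rw [hright (i + 1) (by omega)]) fun _ hω => hω

theorem measure_recurrence_eq_zero_of_left (hf : Measurable f) (hε : 0 < ε) (hfε : ∀ t, ε ≤ f t)
    (hf1 : ∀ t, f t ≤ 1 - ε) (hleft : ∀ x : ℤ, x ≤ -1 → w x = w (-1))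
    (hd : 1 + meanSum f (w (-1)) (driftIncrement f) <
      meanSum f (w (-1)) fun q => -driftIncrement f q) :
    sampleMeasure (recurrence f w) = 0 := by
  have hcomp := (isCompensated_draws hf hε hfε (fun t => (hf1 t).trans (by linarith))
    (w (-1))).flip hε fun _ _ => hf1 _
  have hneg (k : ℕ) (u : ℕ → unitInterval) : 2 * (1 - f (urn f (w (-1)) u k).1) - 1 =
      -driftIncrement f (urn f (w (-1)) u k) := by
    rw [driftIncrement]
    ring
  refine measure_recurrence_eq_zero_of_isDrivenWalk hcomp ?_
    (σ := fun i => -(i + 1)) (fun i j hij => by simpa using hij)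
    (fun ω => (isDrivenWalk_walk f w ω).neg) (fun ω i => ?_) fun ω hω x => ?_
  · simp only [hneg, neg_neg]
    exact hd
  · rw [hleft (-(i + 1)) (by omega)]
  · simpa only [neg_eq_iff_eq_neg] using hω (-x)

end Transience

lemma meanSummable_driftIncrement_or_neg_of_ne_half {f : ℝ → ℝ} {p : ℝ} {s : UrnState}
    (hfc : Continuous f) (hf01 : ∀ t, f t ∈ Set.Icc (0 : ℝ) 1) (hp : IsUniqueFixedPoint f p)
    (hs : IsUrnState s) (hne : p ≠ 1 / 2) :
    MeanSummable f s (driftIncrement f) ∨ MeanSummable f s fun q => -driftIncrement f q :=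
  hne.lt_or_gt.imp
    (fun hlt => (meanSummable_driftIncrement_and_meanSum_neg_eq_top hfc hf01 hp hs hlt).1)
    fun hgt => (meanSummable_neg_driftIncrement_and_meanSum_eq_top hfc hf01 hp hs hgt).1

theorem measure_recurrence_eq_zero_of_ne_half {f : ℝ → ℝ} {w : ℤ → UrnState} {p ε : ℝ}
    (hfc : Continuous f) (hε : 0 < ε) (hfε : ∀ t, f t ∈ Set.Icc ε (1 - ε))
    (hw : ∀ x, IsUrnState (w x)) (hright : ∀ x : ℤ, 1 ≤ x → w x = w 1)
    (hleft : ∀ x : ℤ, x ≤ -1 → w x = w (-1)) (hp : IsUniqueFixedPoint f p) (hne : p ≠ 1 / 2) :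
    sampleMeasure (recurrence f w) = 0 := by
  have hf01 (t : ℝ) : f t ∈ Set.Icc (0 : ℝ) 1 :=
    Set.Icc_subset_Icc hε.le (by linarith) (hfε t)
  rcases hne.lt_or_gt with hlt | hgt
  · obtain ⟨hfin, htop⟩ :=
      meanSummable_driftIncrement_and_meanSum_neg_eq_top hfc hf01 hp (hw (-1)) hlt
    refine measure_recurrence_eq_zero_of_left hfc.measurable hε (fun t => (hfε t).1)
      (fun t => (hfε t).2) hleft ?_
    rw [htop]
    exact ENNReal.add_lt_top.2 ⟨ENNReal.one_lt_top, hfin.lt_top⟩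
  · obtain ⟨hfin, htop⟩ :=
      meanSummable_neg_driftIncrement_and_meanSum_eq_top hfc hf01 hp (hw 1) hgt
    refine measure_recurrence_eq_zero_of_right hfc.measurable hε (fun t => (hfε t).1)
      (fun t => (hf01 t).2) hright ?_
    rw [htop]
    exact ENNReal.add_lt_top.2 ⟨ENNReal.one_lt_top, hfin.lt_top⟩

section Congr

variable {f g : ℝ → ℝ} {w : ℤ → UrnState}

lemma IsUniqueFixedPoint.congr {p : ℝ} (hp : IsUniqueFixedPoint f p)
    (h : Set.EqOn f g (Set.Icc 0 1)) : IsUniqueFixedPoint g p where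
  mem := hp.mem
  eq_self := (h hp.mem).symm.trans hp.eq_self
  unique q hq hgq := hp.unique q hq ((h hq).trans hgq)

lemma urn_congr (h : Set.EqOn f g (Set.Icc 0 1)) {s : UrnState} (hs : IsUrnState s)
    (u : ℕ → unitInterval) (k : ℕ) : urn f s u k = urn g s u k := by
  induction k with
  | zero => rfl
  | succ k ih => simp only [urn, urnStep, ← ih, h (hs.urn f u k).1]

lemma apply_alpha_congr (h : Set.EqOn f g (Set.Icc 0 1)) (hw : ∀ x, IsUrnState (w x))
    (ω : Sample) (x : ℤ) (k : ℕ) : f (alpha f w ω x k) = g (alpha g w ω x k) := by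
  rw [alpha, alpha, h ((hw x).urn f _ k).1, urn_congr h (hw x)]

lemma driftLimit_congr (h : Set.EqOn f g (Set.Icc 0 1)) (hw : ∀ x, IsUrnState (w x)) :
    driftLimit f w = driftLimit g w := by
  funext x ω
  simp only [driftLimit, drift, apply_alpha_congr h hw]

lemma driftWellDefined_congr (h : Set.EqOn f g (Set.Icc 0 1)) (hw : ∀ x, IsUrnState (w x))
    (x : ℤ) : DriftWellDefined f w x ↔ DriftWellDefined g w x := by
  simp only [DriftWellDefined, driftLimit_congr h hw, drift, driftPos, driftNeg,
    apply_alpha_congr h hw]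

lemma recurrence_congr (h : Set.EqOn f g (Set.Icc 0 1)) (hw : ∀ x, IsUrnState (w x)) :
    recurrence f w = recurrence g w := by
  have hstate (ω : Sample) (n : ℕ) : walkState f w ω n = walkState g w ω n := by
    induction n with
    | zero => rfl
    | succ n ih => simp only [walkState, ih, apply_alpha_congr h hw]
  simp only [recurrence, walk, hstate]

end Congr

lemma exists_continuous_eqOn_Icc {f : ℝ → ℝ} (hf : ContinuousOn f (Set.Icc 0 1))
    (hf01 : ∀ t ∈ Set.Icc (0 : ℝ) 1, f t ∈ Set.Ioo (0 : ℝ) 1) :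
    ∃ g : ℝ → ℝ, Continuous g ∧ Set.EqOn f g (Set.Icc 0 1) ∧
      ∃ ε > 0, ∀ t, g t ∈ Set.Icc ε (1 - ε) := by
  have hmin : ContinuousOn (fun t => min (f t) (1 - f t)) (Set.Icc 0 1) := by fun_prop
  obtain ⟨ε, hε, hfε⟩ := isCompact_Icc.exists_forall_le' hmin
    fun t ht => lt_min (hf01 t ht).1 (sub_pos.2 (hf01 t ht).2)
  refine ⟨fun t => f (Set.projIcc (0 : ℝ) 1 zero_le_one t),
    hf.comp_continuous (by fun_prop) fun t => Subtype.mem _, fun t ht => ?_, ε, hε, fun t => ?_⟩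
  · simp only [Set.projIcc_of_mem zero_le_one ht]
  · have h := hfε _ (Set.projIcc (0 : ℝ) 1 zero_le_one t).2
    exact ⟨h.trans (min_le_left _ _), le_sub_comm.1 (h.trans (min_le_right _ _))⟩

end RRW

theorem theorem2_general
    (f : ℝ → ℝ)
    (hf : ContinuousOn f (Set.Icc 0 1))
    (hf01 : ∀ t ∈ Set.Icc (0 : ℝ) 1, f t ∈ Set.Ioo (0 : ℝ) 1)
    (w : ℤ → RRW.UrnState)
    (hw : ∀ x, (w x).1 ∈ Set.Icc (0 : ℝ) 1 ∧ 0 < (w x).2)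
    (hright : ∀ x : ℤ, 1 ≤ x → w x = w 1)
    (hleft : ∀ x : ℤ, x ≤ -1 → w x = w (-1))
    (p : ℝ) (hp : p ∈ Set.Icc (0 : ℝ) 1) (hfp : f p = p)
    (huniq : ∀ q ∈ Set.Icc (0 : ℝ) 1, f q = q → q = p) :
    (p ≠ 1 / 2 →
      (∀ x : ℤ, RRW.DriftWellDefined f w x) ∧
      RRW.sampleMeasure (RRW.recurrence f w) = 0) ∧
    (p = 1 / 2 → ContDiffAt ℝ 3 f (1 / 2) → deriv f (1 / 2) = 0 →
      (∀ x : ℤ, RRW.DriftWellDefined f w x) ∧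
      (1 < RRW.expectation RRW.sampleMeasure (RRW.driftLimit f w 1) ∨
          RRW.expectation RRW.sampleMeasure (RRW.driftLimit f w (-1)) < -1 →
        RRW.sampleMeasure (RRW.recurrence f w) = 0)) := by
  obtain ⟨g, hg, hfg, ε, hε, hgε⟩ := RRW.exists_continuous_eqOn_Icc hf hf01
  have hg01 (t : ℝ) : g t ∈ Set.Icc (0 : ℝ) 1 :=
    Set.Icc_subset_Icc hε.le (sub_le_self 1 hε.le) (hgε t)
  have hgp := RRW.IsUniqueFixedPoint.congr ⟨hp, hfp, huniq⟩ hfg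
  simp only [RRW.driftWellDefined_congr hfg hw, RRW.recurrence_congr hfg hw,
    RRW.driftLimit_congr hfg hw]
  refine ⟨fun hne => ⟨fun x => RRW.driftWellDefined_of_meanSummable hg.measurable
    (RRW.meanSummable_driftIncrement_or_neg_of_ne_half hg hg01 hgp (hw x) hne),
    RRW.measure_recurrence_eq_zero_of_ne_half hg hε hgε hw hright hleft hgp hne⟩, ?_⟩
  rintro rfl hsmooth hcrit
  have hnear : f =ᶠ[𝓝 (1 / 2)] g :=
    hfg.eventuallyEq_of_mem (Icc_mem_nhds (by norm_num) (by norm_num))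
  have hsum (x : ℤ) := RRW.meanSummable_driftIncrement_or_neg hg hg01 hgp (hw x)
    (hsmooth.congr_of_eventuallyEq hnear.symm) (hnear.deriv_eq.symm.trans hcrit)
  refine ⟨fun x => RRW.driftWellDefined_of_meanSummable hg.measurable (hsum x), ?_⟩
  rintro (hE | hE)
  · exact RRW.measure_recurrence_eq_zero_of_right hg.measurable hε (fun t => (hgε t).1)
      (fun t => (hg01 t).2) hright (RRW.one_add_lt_of_one_lt_expectation hg.measurable (hsum 1) hE)
  · exact RRW.measure_recurrence_eq_zero_of_left hg.measurable hε (fun t => (hgε t).1)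
      (fun t => (hgε t).2) hleft
      (RRW.one_add_lt_of_expectation_lt_neg_one hg.measurable (hsum (-1)) hE)

theorem theorem2
    (f : ℝ → ℝ)
    (hf : ContDiffOn ℝ 3 f (Set.Icc 0 1))
    (hf01 : ∀ t ∈ Set.Icc (0 : ℝ) 1, f t ∈ Set.Ioo (0 : ℝ) 1)
    (w : ℤ → RRW.UrnState)
    (hw : ∀ x, (w x).1 ∈ Set.Icc (0 : ℝ) 1 ∧ 0 < (w x).2)
    (hright : ∀ x : ℤ, 1 ≤ x → w x = w 1)
    (hleft : ∀ x : ℤ, x ≤ -1 → w x = w (-1))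
    (p : ℝ) (hp : p ∈ Set.Icc (0 : ℝ) 1) (hfp : f p = p)
    (huniq : ∀ q ∈ Set.Icc (0 : ℝ) 1, f q = q → q = p) :
    (p ≠ 1 / 2 →
      (∀ x : ℤ, RRW.DriftWellDefined f w x) ∧
      RRW.sampleMeasure (RRW.recurrence f w) = 0) ∧
    (p = 1 / 2 → deriv f (1 / 2) = 0 →
      (∀ x : ℤ, RRW.DriftWellDefined f w x) ∧
      (1 < RRW.expectation RRW.sampleMeasure (RRW.driftLimit f w 1) ∨
          RRW.expectation RRW.sampleMeasure (RRW.driftLimit f w (-1)) < -1 →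
        RRW.sampleMeasure (RRW.recurrence f w) = 0)) :=
  (theorem2_general f hf.continuousOn hf01 w hw hright hleft p hp hfp huniq).imp_right
    fun h hhalf => h hhalf (hf.contDiffAt (Icc_mem_nhds (by norm_num) (by norm_num)))
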